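/- Let $1<\alpha<2$. For a function $u$ on $\mathbb R$ and $-\infty\le a<b\le+\infty$ let $${}_aD_x^\alpha u(x)=\frac{1}{\Gamma(2-\alpha)}\frac{d^2}{dx^2}\int_a^x (x-s)^{1-\alpha}u(s)\,ds,\qquad {}_xD_b^\alpha u(x)=\frac{1}{\Gamma(2-\alpha)}\frac{d^2}{dx^2}\int_x^b (s-x)^{1-\alpha}u(s)\,ds$$ be the left and right Riemann--Liouville derivatives (for finite $a$, the integral $\int_a^x$ is read as $0$ when $x\le a$; for finite $b$, $\int_x^b$ is read as $0$ when $x\ge b$). Let $g_k^{(\alpha)}=\frac{\Gamma(k-\alpha)}{\Gamma(-\alpha)\Gamma(k+1)}$ and, for a step $h>0$ and an integer $p$, put $$\Delta_p^\alpha u(x)=\frac1{h^\alpha}\sum_{k=0}^\infty g_k^{(\alpha)}u(x-(k-p)h),\qquad \Lambda_p^\alpha u(x)=\frac1{h^\alpha}\sum_{k=0}^\infty g_k^{(\alpha)}u(x+(k-p)h),$$ $$\tilde\Delta_p^\alpha u(x)=\frac1{h^\alpha}\sum_{k=0}^{\lfloor (x-a)/h\rfloor+p} g_k^{(\alpha)}u(x-(k-p)h),\qquad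 \tilde\Lambda_p^\alpha u(x)=\frac1{h^\alpha}\sum_{k=0}^{\lfloor (b-x)/h\rfloor+p} g_k^{(\alpha)}u(x+(k-p)h),$$ the last two for finite $a$, $b$ respectively (a sum with negative upper limit is $0$). Let $\delta_x^2v(x)=\frac{v(x-h)-2v(x)+v(x+h)}{h^2}$, $P_x=1+h^2b_2^\alpha\delta_x^2$, and $$\mu_1=\tfrac{(1+\alpha)(2+\alpha)}{12},\quad \mu_0=-\tfrac{(-2+\alpha)(2+\alpha)}{6},\quad \mu_{-1}=\tfrac{(-2+\alpha)(-1+\alpha)}{12},\quad b_2^\alpha=\tfrac{4+\alpha-\alpha^2}{24}.$$ (1) Let $u\in C^7(\mathbb R)$ be real-valued such that $u$ and all its derivatives up to order $7$ belong to $L^1(\mathbb R)$. Then ${}_{-\infty}D_x^\alpha u$ and ${}_xD_{+\infty}^\alpha u$ exist on $\mathbb R$ (the integrals converge absolutely and are twice continuously differentiable in $x$), the series $\Delta_p^\alpha u(x)$ and $\Lambda_p^\alpha u(x)$ converge absolutely for all $p\in\mathbb Z$, $h>0$, $x\in\mathbb R$, and, as $h\to0^+$, $$P_x\,{}_{-\infty}D_x^\alpha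 u(x)=\mu_1\Delta_1^\alpha u(x)+\mu_0\Delta_0^\alpha u(x)+\mu_{-1}\Delta_{-1}^\alpha u(x)+O(h^4),$$ $$P_x\,{}_xD_{+\infty}^\alpha u(x)=\mu_1\Lambda_1^\alpha u(x)+\mu_0\Lambda_0^\alpha u(x)+\mu_{-1}\Lambda_{-1}^\alpha u(x)+O(h^4),$$ uniformly in $x\in\mathbb R$. (2) Let $-\infty<a<b<\infty$ and let $u:[a,b]\to\mathbb R$ be such that its extension by zero to $\mathbb R$, again denoted by $u$, satisfies the assumptions of (1). Then ${}_aD_x^\alpha u$ and ${}_xD_b^\alpha u$ exist on $\mathbb R$ (in the sense of (1)) and, as $h\to0^+$, $$P_x\,{}_aD_x^\alpha u(x)=\mu_1\tilde\Delta_1^\alpha u(x)+\mu_0\tilde\Delta_0^\alpha u(x)+\mu_{-1}\tilde\Delta_{-1}^\alpha u(x)+O(h^4),$$ $$P_x\,{}_xD_b^\alpha u(x)=\mu_1\tilde\Lambda_1^\alpha u(x)+\mu_0\tilde\Lambda_0^\alpha u(x)+\mu_{-1}\tilde\Lambda_{-1}^\alpha u(x)+O(h^4),$$ uniformly in $x\in[a,b]$.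 -/

import Mathlib

open MeasureTheory Set

namespace QuasiCompact

noncomputable section

/-- The integral `∫_a^x (x - s)^(n - α - 1) u(s) ds` with `n = ⌈α⌉`
(so `n - 1 < α < n` for non-integer `α`); `a = ⊥` means `a = -∞`. -/
def leftIntegral (α : ℝ) (a : EReal) (u : ℝ → ℝ) (x : ℝ) : ℝ :=
  ∫ s in {s : ℝ | a < (s : EReal) ∧ s < x}, (x - s) ^ ((⌈α⌉₊ : ℝ) - α - 1) * u s

/-- The integral `∫_x^b (s - x)^(n - α - 1) u(s) ds` with `n = ⌈α⌉`; `b = ⊤` means `b = +∞`. -/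
def rightIntegral (α : ℝ) (b : EReal) (u : ℝ → ℝ) (x : ℝ) : ℝ :=
  ∫ s in {s : ℝ | x < s ∧ (s : EReal) < b}, (s - x) ^ ((⌈α⌉₊ : ℝ) - α - 1) * u s

/-- The left Riemann-Liouville derivative `_a D_x^α u` (for non-integer `α > 0`). -/
def leftRL (α : ℝ) (a : EReal) (u : ℝ → ℝ) (x : ℝ) : ℝ :=
  1 / Real.Gamma ((⌈α⌉₊ : ℝ) - α) * iteratedDeriv ⌈α⌉₊ (leftIntegral α a u) x

/-- The right Riemann-Liouville derivative `_x D_b^α u` (for non-integer `α > 0`). -/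
def rightRL (α : ℝ) (b : EReal) (u : ℝ → ℝ) (x : ℝ) : ℝ :=
  (-1) ^ ⌈α⌉₊ / Real.Gamma ((⌈α⌉₊ : ℝ) - α) * iteratedDeriv ⌈α⌉₊ (rightIntegral α b u) x

/-- `_a D_x^α u` exists on all of `ℝ`: the defining integral converges absolutely for every `x`
and is `n` times continuously differentiable in `x`. -/
def LeftRLExists (α : ℝ) (a : EReal) (u : ℝ → ℝ) : Prop :=
  (∀ x : ℝ, IntegrableOn (fun s : ℝ => (x - s) ^ ((⌈α⌉₊ : ℝ) - α - 1) * u s)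
    {s : ℝ | a < (s : EReal) ∧ s < x}) ∧
  ContDiff ℝ ⌈α⌉₊ (leftIntegral α a u)

/-- `_x D_b^α u` exists on all of `ℝ`. -/
def RightRLExists (α : ℝ) (b : EReal) (u : ℝ → ℝ) : Prop :=
  (∀ x : ℝ, IntegrableOn (fun s : ℝ => (s - x) ^ ((⌈α⌉₊ : ℝ) - α - 1) * u s)
    {s : ℝ | x < s ∧ (s : EReal) < b}) ∧
  ContDiff ℝ ⌈α⌉₊ (rightIntegral α b u)

/-- The Grünwald weights `g_k^(α)`. -/
def gWeight (α : ℝ) (k : ℕ) : ℝ :=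
  Real.Gamma ((k : ℝ) - α) / (Real.Gamma (-α) * Real.Gamma ((k : ℝ) + 1))

/-- The left shifted Grünwald-Letnikov operator `Δ_p^α` with step `h`. -/
def leftGL (α h : ℝ) (p : ℤ) (u : ℝ → ℝ) (x : ℝ) : ℝ :=
  1 / h ^ α * ∑' k : ℕ, gWeight α k * u (x - ((k : ℝ) - (p : ℝ)) * h)

/-- The right shifted Grünwald-Letnikov operator `Λ_p^α` with step `h`. -/
def rightGL (α h : ℝ) (p : ℤ) (u : ℝ → ℝ) (x : ℝ) : ℝ :=
  1 / h ^ α * ∑' k : ℕ, gWeight α k * u (x + ((k : ℝ) - (p : ℝ)) * h)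

/-- The left operator on an interval with left end `a`: the sum over `0 ≤ k ≤ [(x - a)/h] + p`
(empty if that bound is negative). -/
def leftGLFinite (α a h : ℝ) (p : ℤ) (u : ℝ → ℝ) (x : ℝ) : ℝ :=
  1 / h ^ α * ∑ k ∈ Finset.range (⌊(x - a) / h⌋ + p + 1).toNat,
    gWeight α k * u (x - ((k : ℝ) - (p : ℝ)) * h)

/-- The right operator on an interval with right end `b`: the sum over
`0 ≤ k ≤ [(b - x)/h] + p` (empty if that bound is negative). -/
def rightGLFinite (α b h : ℝ) (p : ℤ) (u : ℝ → ℝ) (x : ℝ) : ℝ :=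
  1 / h ^ α * ∑ k ∈ Finset.range (⌊(b - x) / h⌋ + p + 1).toNat,
    gWeight α k * u (x + ((k : ℝ) - (p : ℝ)) * h)

/-- The centered second difference `δ_x^2`. -/
def centeredDiff (h : ℝ) (v : ℝ → ℝ) (x : ℝ) : ℝ :=
  (v (x - h) - 2 * v x + v (x + h)) / h ^ 2

def muOne (α : ℝ) : ℝ := (1 + α) * (2 + α) / 12

def muZero (α : ℝ) : ℝ := -((-2 + α) * (2 + α) / 6)

def muNegOne (α : ℝ) : ℝ := (-2 + α) * (-1 + α) / 12

def bTwo (α : ℝ) : ℝ := (4 + α - α ^ 2) / 24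

/-- The operator `P_x = 1 + h^2 b_2^α δ_x^2`. -/
def cwsgd (α h : ℝ) (v : ℝ → ℝ) (x : ℝ) : ℝ :=
  v x + h ^ 2 * bTwo α * centeredDiff h v x

/-- `u ∈ C^7(ℝ)`, and `u` and its derivatives up to order `7` belong to `L^1(ℝ)`. -/
def SmoothIntegrable (u : ℝ → ℝ) : Prop :=
  ContDiff ℝ 7 u ∧ ∀ k : ℕ, k ≤ 7 → Integrable (iteratedDeriv k u)

/-- The extension by zero to `ℝ` of a function given on `[a, b]`. -/
def zeroExt (a b : ℝ) (u : ℝ → ℝ) : ℝ → ℝ := (Icc a b).indicator u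

/-- `E h x = O(h^4)` as `h → 0+`, uniformly in `x ∈ S`. -/
def UniformBigO (S : Set ℝ) (E : ℝ → ℝ → ℝ) : Prop :=
  ∃ C : ℝ, ∃ h₀ : ℝ, 0 < h₀ ∧ ∀ h : ℝ, 0 < h → h < h₀ → ∀ x ∈ S, |E h x| ≤ C * h ^ 4

end

end QuasiCompact

open scoped FourierTransform

namespace QuasiCompact

/-! Everything is a multiplier estimate on the Fourier side. Write `u x = ∫ spec u w * e^{-2πiwx}
dw`, `ζ = zeta w = -2πiw` and `θ = angle h w = -2πwh`, so that `iθ = hζ`. The left derivative has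
symbol `ζ^α` (`ofReal_leftRL`), the shifted sum `Δ_p` has symbol `h^(-α) (1 - e^{-iθ})^α e^{ipθ}`
(`ofReal_leftGL`), and `P_x` multiplies by `1 + b₂(2cos θ - 2)`. The error is therefore `h^(-α)`
times an integral of `errSymbol α θ * spec u w` against unimodular exponentials
(`ofReal_leftError`).

The weights `μ` and `b₂` cancel all terms of relative order below four, giving `‖errSymbol α θ‖ ≤ C
|θ|^(α+4)` for all real `θ` (`norm_errSymbol_le`). Seven integrable derivatives make `spec u` decay
like `|w|^(-7)`, and `α + 4 < 6`, so `|w|^(α+4) spec u` is integrable and the error is `O(h^4)`,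
uniformly in `x`.

The delicate symbol is that of the fractional integral, whose kernel `t^(1-α)` is not integrable: it
is damped by `e^{-εt}`, Fubini is applied, and `ε → 0+` (`integral_rpow_mul_comp_sub_eq`).
Right-sided claims follow by reflection; on an interval the zero extension turns the finite
operators into those on the line. -/

/-! ### Grünwald weights and their generating function. -/

lemma gWeight_zero {α : ℝ} (hα₁ : 1 < α) (hα₂ : α < 2) : gWeight α 0 = 1 := by
  have h : Real.Gamma (-α) ≠ 0 := Real.Gamma_ne_zero fun m => by
    intro h
    have h1 : (1 : ℝ) < m := by linarith
    have h2 : (m : ℝ) < 2 := by linarith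
    norm_cast at h1 h2
    omega
  simp [gWeight, h]

lemma gWeight_succ {α : ℝ} (hα₁ : 1 < α) (hα₂ : α < 2) (k : ℕ) :
    ((k : ℝ) + 1) * gWeight α (k + 1) = (k - α) * gWeight α k := by
  have h1 : (k : ℝ) - α ≠ 0 := by
    intro h
    have h1 : (1 : ℝ) < k := by linarith
    have h2 : (k : ℝ) < 2 := by linarith
    norm_cast at h1 h2
    omega
  have h2 : (k : ℝ) + 1 ≠ 0 := by positivity
  have h3 : Real.Gamma ((k : ℝ) + 1) ≠ 0 := (Real.Gamma_pos_of_pos (by positivity)).ne'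
  unfold gWeight
  push_cast
  rw [show (k : ℝ) + 1 - α = (k - α) + 1 by ring, Real.Gamma_add_one h1, Real.Gamma_add_one h2]
  field_simp

/-- The recurrence factor `k - α` is positive from `k = 2` on, and the weight at `2` is `α(α-1)/2 >
0`; only the weight at `1` is negative. -/
lemma gWeight_two_add_nonneg {α : ℝ} (hα₁ : 1 < α) (hα₂ : α < 2) (k : ℕ) :
    0 ≤ gWeight α (k + 2) := by
  induction k with
  | zero =>
    have h0 := gWeight_succ hα₁ hα₂ 0
    have h1 := gWeight_succ hα₁ hα₂ 1
    rw [gWeight_zero hα₁ hα₂] at h0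
    norm_num at h0 h1 ⊢
    rw [h0] at h1
    nlinarith
  | succ k ih =>
    have h := gWeight_succ hα₁ hα₂ (k + 2)
    push_cast at h
    have h2 : 0 ≤ ((k : ℝ) + 2 - α) * gWeight α (k + 2) :=
      mul_nonneg (by have : (0 : ℝ) ≤ k := by positivity
                     linarith) ih
    rw [← h] at h2
    exact nonneg_of_mul_nonneg_right h2 (by positivity)

/-- The right side is the `n`-th weight for exponent `α - 1`: partial sums are the coefficients of
`(1-ζ)^α / (1-ζ)`. -/
lemma sum_range_gWeight {α : ℝ} (hα₁ : 1 < α) (hα₂ : α < 2) (n : ℕ) :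
    ∑ k ∈ Finset.range (n + 1), gWeight α k = -((n - α) / α) * gWeight α n := by
  have h0 : α ≠ 0 := by linarith
  induction n with
  | zero => simp [h0]
  | succ n ih =>
    rw [Finset.sum_range_succ, ih]
    have h := gWeight_succ hα₁ hα₂ n
    push_cast
    field_simp
    linarith

/-- From index `2` on the terms are nonnegative, and the closed form makes the full partial sums
nonpositive, so the tail sums stay below `-(g₀ + g₁)`. -/
lemma summable_gWeight {α : ℝ} (hα₁ : 1 < α) (hα₂ : α < 2) : Summable (gWeight α) := by
  rw [← summable_nat_add_iff 2]
  refine summable_of_sum_range_le (c := -(gWeight α 0 + gWeight α 1))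
    (gWeight_two_add_nonneg hα₁ hα₂) fun n => ?_
  have h := sum_range_gWeight hα₁ hα₂ (n + 2)
  rw [Finset.sum_range_succ, Finset.sum_range_succ', Finset.sum_range_succ'] at h
  have h1 := gWeight_two_add_nonneg hα₁ hα₂ n
  have h2 : 0 ≤ (((n + 2 : ℕ) : ℝ) - α) / α * gWeight α (n + 2) := by
    refine mul_nonneg (div_nonneg ?_ (by linarith)) h1
    have : (0 : ℝ) ≤ n := by positivity
    push_cast
    linarith
  simp only [zero_add] at h
  linarith

lemma gWeight_eq_choose {α : ℝ} (hα₁ : 1 < α) (hα₂ : α < 2) (k : ℕ) :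
    gWeight α k = (-1) ^ k * Ring.choose α k := by
  induction k with
  | zero => simp [gWeight_zero hα₁ hα₂]
  | succ k ih =>
    have h := gWeight_succ hα₁ hα₂ k
    have h1 := Ring.descPochhammer_eq_factorial_smul_choose α (k + 1)
    have h2 := Ring.descPochhammer_eq_factorial_smul_choose α k
    rw [descPochhammer_succ_right, Polynomial.smeval_mul, h2] at h1
    have hk : (k : ℝ) + 1 ≠ 0 := by positivity
    have hf : (k.factorial : ℝ) ≠ 0 := by positivity
    simp [Polynomial.smeval_sub, Polynomial.smeval_natCast, Nat.factorial_succ] at h1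
    rw [ih] at h
    apply mul_left_cancel₀ hk
    rw [h]
    apply mul_left_cancel₀ hf
    rw [pow_succ]
    linear_combination (-1) ^ k * (-h1)

lemma hasSum_gWeight_of_norm_lt_one {α : ℝ} (hα₁ : 1 < α) (hα₂ : α < 2) {ζ : ℂ} (h : ‖ζ‖ < 1) :
    HasSum (fun k : ℕ => (gWeight α k : ℂ) * ζ ^ k) ((1 - ζ) ^ (α : ℂ)) := by
  have := (Complex.one_add_cpow_hasFPowerSeriesOnBall_zero (a := (α : ℂ))).hasSum (y := -ζ)
    (by simpa [← ofReal_norm, enorm_eq_nnnorm, ← NNReal.coe_lt_one] using h)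
  simp only [zero_add, binomialSeries_apply] at this
  rw [← sub_eq_add_neg] at this
  refine this.congr_fun fun k => ?_
  rw [gWeight_eq_choose hα₁ hα₂]
  simp [neg_pow ζ, Complex.ofReal_choose]
  ring

/-- The symbol needs the unit circle `ζ = e^{-iθ}`. Summable weights make the series continuous on
the closed disc, the power is continuous there too, and the two agree inside. -/
lemma hasSum_gWeight {α : ℝ} (hα₁ : 1 < α) (hα₂ : α < 2) {ζ : ℂ} (h : ‖ζ‖ ≤ 1) :
    HasSum (fun k : ℕ => (gWeight α k : ℂ) * ζ ^ k) ((1 - ζ) ^ (α : ℂ)) := by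
  have hs := (summable_gWeight hα₁ hα₂).abs
  have hb : ∀ (k : ℕ) (z : ℂ), z ∈ Metric.closedBall (0 : ℂ) 1 →
      ‖(gWeight α k : ℂ) * z ^ k‖ ≤ |gWeight α k| := fun k z hz => by
    rw [norm_mul, norm_pow, Complex.norm_real, Real.norm_eq_abs]
    exact mul_le_of_le_one_right (abs_nonneg _)
      (pow_le_one₀ (norm_nonneg _) (by simpa using hz))
  have hc : ContinuousOn (fun z : ℂ => ∑' k : ℕ, (gWeight α k : ℂ) * z ^ k)
      (Metric.closedBall 0 1) := continuousOn_tsum (fun k => by fun_prop) hs hb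
  have hc' : ContinuousOn (fun z : ℂ => (1 - z) ^ (α : ℂ)) (Metric.closedBall 0 1) := by
    intro z hz
    refine ContinuousAt.continuousWithinAt ?_
    -- At `z = 1` continuity comes from `Re α > 0`; elsewhere `Re (1 - z) ≥ 0` and `1 - z ≠ 0` keep
    -- the base off the branch cut.
    by_cases h1 : 1 - z = 0
    · have : ContinuousAt (fun y : ℂ => y ^ (α : ℂ)) (1 - z) := by
        rw [h1]
        have := Complex.continuousAt_cpow_zero_of_re_pos (z := (α : ℂ)) (by simp; linarith)
        exact this.comp (f := fun y : ℂ => (y, (α : ℂ))) (by fun_prop)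
      exact this.comp (f := fun y : ℂ => 1 - y) (by fun_prop)
    · refine ContinuousAt.cpow (by fun_prop) (by fun_prop) ?_
      rw [Complex.mem_slitPlane_iff]
      by_contra hcon
      push Not at hcon
      have h2 : z.re ≤ 1 := (Complex.re_le_norm z).trans (by simpa using hz)
      apply h1
      apply Complex.ext
      · simp at hcon ⊢
        linarith [hcon.1]
      · simpa using hcon.2
  have heq : EqOn (fun z : ℂ => ∑' k : ℕ, (gWeight α k : ℂ) * z ^ k)
      (fun z : ℂ => (1 - z) ^ (α : ℂ)) (Metric.closedBall 0 1) := by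
    refine EqOn.of_subset_closure (s := Metric.ball 0 1) ?_ hc hc' Metric.ball_subset_closedBall ?_
    · intro z hz
      exact (hasSum_gWeight_of_norm_lt_one hα₁ hα₂ (by simpa using hz)).tsum_eq
    · rw [closure_ball _ one_ne_zero]
  have hz : ζ ∈ Metric.closedBall (0 : ℂ) 1 := by simpa using h
  rw [show (1 - ζ) ^ (α : ℂ) = _ from (heq hz).symm]
  exact (Summable.of_norm_bounded hs fun k => hb k ζ hz).hasSum

/-! ### The error symbol is of order `|θ|^(α+4)`. -/

/-- The Fourier multiplier of `h^α` times the weighted sum of the shifted Grünwald operators,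
at `θ = h ω`. -/
noncomputable def glSymbol (α θ : ℝ) : ℂ :=
  (1 - Complex.exp (-(θ * Complex.I))) ^ (α : ℂ) *
    (muOne α * Complex.exp (θ * Complex.I) + muZero α + muNegOne α * Complex.exp (-(θ * Complex.I)))

/-- The Fourier multiplier of `h^α` times the error of the quasi-compact scheme. -/
noncomputable def errSymbol (α θ : ℝ) : ℂ :=
  (θ * Complex.I) ^ (α : ℂ) * (1 + bTwo α * (2 * Real.cos θ - 2) : ℝ) - glSymbol α θ

/-- Polar form: `1 - e^{-iθ} = 2 sin(θ/2) e^{i(π/2 - θ/2)}`, with argument in the principal range,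
so the logarithms can be read off. -/
lemma one_sub_exp_neg_cpow {α θ : ℝ} (h0 : 0 < θ) (h1 : θ ≤ 1) :
    (1 - Complex.exp (-(θ * Complex.I))) ^ (α : ℂ) =
      (θ * Complex.I) ^ (α : ℂ) * ((Real.sin (θ / 2) / (θ / 2)) ^ α : ℝ) *
        Complex.exp (-(α * θ / 2 * Complex.I)) := by
  have hs : 0 < Real.sin (θ / 2) := Real.sin_pos_of_pos_of_lt_pi (by linarith)
    (by linarith [Real.pi_gt_three])
  have e1 : 1 - Complex.exp (-(θ * Complex.I)) =
      Complex.exp (((Real.log (2 * Real.sin (θ / 2)) : ℝ) : ℂ) +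
        ((Real.pi / 2 - θ / 2 : ℝ) : ℂ) * Complex.I) := by
    rw [Complex.exp_add, ← Complex.ofReal_exp, Real.exp_log (by positivity)]
    apply Complex.ext
    · simp [-Complex.ofReal_sin, Complex.exp_re, Complex.exp_im, Real.cos_pi_div_two_sub,
        Real.sin_pi_div_two_sub]
      have := Real.cos_two_mul (θ / 2)
      rw [show 2 * (θ / 2) = θ by ring] at this
      rw [this]
      nlinarith [Real.sin_sq_add_cos_sq (θ / 2)]
    · simp [-Complex.ofReal_sin, Complex.exp_re, Complex.exp_im, Real.cos_pi_div_two_sub,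
        Real.sin_pi_div_two_sub]
      have := Real.sin_two_mul (θ / 2)
      rw [show 2 * (θ / 2) = θ by ring] at this
      rw [this]
  have e2 : (θ * Complex.I) = Complex.exp (((Real.log θ : ℝ) : ℂ) +
      ((Real.pi / 2 : ℝ) : ℂ) * Complex.I) := by
    rw [Complex.exp_add, ← Complex.ofReal_exp, Real.exp_log h0]
    push_cast
    rw [Complex.exp_pi_div_two_mul_I]
  have l1 : Complex.log (1 - Complex.exp (-(θ * Complex.I))) =
      ((Real.log (2 * Real.sin (θ / 2)) : ℝ) : ℂ) +
        ((Real.pi / 2 - θ / 2 : ℝ) : ℂ) * Complex.I := by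
    rw [e1]
    apply Complex.log_exp <;> simp <;> linarith [Real.pi_gt_three]
  have l2 : Complex.log (θ * Complex.I) = ((Real.log θ : ℝ) : ℂ) +
      ((Real.pi / 2 : ℝ) : ℂ) * Complex.I := by
    rw [e2]
    apply Complex.log_exp <;> simp <;> linarith [Real.pi_gt_three]
  rw [Complex.cpow_def_of_ne_zero (by rw [e1]; exact Complex.exp_ne_zero _),
    Complex.cpow_def_of_ne_zero (by rw [e2]; exact Complex.exp_ne_zero _), l1, l2,
    Real.rpow_def_of_pos (by positivity), Complex.ofReal_exp, ← Complex.exp_add, ← Complex.exp_add]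
  congr 1
  rw [show Real.sin (θ / 2) / (θ / 2) = 2 * Real.sin (θ / 2) / θ by field_simp,
    Real.log_div (by positivity) h0.ne']
  push_cast
  ring

lemma norm_ofReal_mul_I_cpow {α : ℝ} (hα : α ≠ 0) (θ : ℝ) :
    ‖((θ : ℂ) * Complex.I) ^ (α : ℂ)‖ = |θ| ^ α := by
  by_cases h0 : θ = 0
  · simp [h0, hα]
  · rw [Complex.norm_cpow_of_ne_zero (by simp [h0])]
    simp

lemma norm_exp_mul_I_sub_taylor_le {y : ℝ} (hy : |y| ≤ 1) :
    ‖Complex.exp (y * Complex.I) -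
      (1 + y * Complex.I - y ^ 2 / 2 - y ^ 3 / 6 * Complex.I)‖ ≤ y ^ 4 := by
  have h := Complex.exp_bound (x := y * Complex.I) (by simpa using hy) (n := 4) (by norm_num)
  simp only [Finset.sum_range_succ, Finset.sum_range_zero, norm_mul, Complex.norm_real,
    Complex.norm_I, mul_one, Real.norm_eq_abs, mul_pow, Complex.I_pow_three, Complex.I_sq,
    pow_zero, Nat.factorial, pow_one, (even_two_mul 2).pow_abs, show 4 = 2 * 2 from rfl] at h
  have h2 : y ^ 4 * (5 / 96) ≤ y ^ 4 := mul_le_of_le_one_right (by positivity) (by norm_num)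
  norm_num at h
  refine le_trans (le_of_eq ?_) (h.trans h2)
  congr 1
  ring

/-- Bernoulli twice: convex with exponent `α` from below, concave with exponent `α - 1` from above.
The difference lies between `0` and `(α-1)y²`. -/
lemma abs_one_add_rpow_sub_le {α y : ℝ} (hα₁ : 1 < α) (hα₂ : α < 2) (hy : -1 < y) :
    |(1 + y) ^ α - (1 + α * y)| ≤ y ^ 2 := by
  have h1 := one_add_mul_self_le_rpow_one_add hy.le hα₁.le
  have h2 := rpow_one_add_le_one_add_mul_self hy.le (p := α - 1) (by linarith) (by linarith)
  have h3 : (1 + y) ^ α = (1 + y) * (1 + y) ^ (α - 1) := by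
    rw [Real.rpow_sub_one (by linarith)]
    field_simp [show 1 + y ≠ 0 by linarith]
  have h4 := mul_le_mul_of_nonneg_left h2 (show 0 ≤ 1 + y by linarith)
  rw [abs_of_nonneg (by linarith)]
  nlinarith [sq_nonneg y]

lemma abs_sinc_sub_le {x : ℝ} (h0 : 0 < x) (h1 : x ≤ 1) :
    |Real.sin x / x - 1 - (- x ^ 2 / 6)| ≤ x ^ 4 / 100 := by
  have h := Real.sin_bound (x := x) (by rwa [abs_of_pos h0])
  rw [abs_of_pos h0] at h
  have : Real.sin x / x - 1 - (- x ^ 2 / 6) = (Real.sin x - (x - x ^ 3 / 6)) / x := by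
    field_simp
    ring
  rw [this, abs_div, abs_of_pos h0, div_le_iff₀ h0]
  linarith [show x ^ 4 / 100 * x = x ^ 5 / 100 by ring]

lemma abs_sinc_rpow_sub_le {α x : ℝ} (hα₁ : 1 < α) (hα₂ : α < 2) (h0 : 0 < x) (h1 : x ≤ 1) :
    |(Real.sin x / x) ^ α - (1 - α * x ^ 2 / 6)| ≤ x ^ 4 := by
  have hs := abs_sinc_sub_le h0 h1
  have hp : 0 < Real.sin x / x := div_pos (Real.sin_pos_of_pos_of_le_one h0 h1) h0
  obtain ⟨r, hr⟩ : ∃ r, r = Real.sin x / x - 1 - (- x ^ 2 / 6) := ⟨_, rfl⟩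
  obtain ⟨y, hy⟩ : ∃ y, y = Real.sin x / x - 1 := ⟨_, rfl⟩
  rw [← hr] at hs
  have hb := abs_one_add_rpow_sub_le hα₁ hα₂ (y := y) (by linarith)
  rw [show 1 + y = Real.sin x / x by linarith] at hb
  have hx2 : x ^ 2 ≤ 1 := pow_le_one₀ h0.le h1
  have hx4 : x ^ 4 ≤ x ^ 2 := by nlinarith [sq_nonneg x]
  have hy2 : y ^ 2 ≤ x ^ 4 / 16 := by
    have : |y| ≤ x ^ 2 / 4 := by
      rw [abs_le] at hs ⊢
      constructor <;> nlinarith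
    calc y ^ 2 = |y| ^ 2 := (sq_abs y).symm
      _ ≤ (x ^ 2 / 4) ^ 2 := by gcongr
      _ = x ^ 4 / 16 := by ring
  have hr' : |α * r| ≤ 2 * (x ^ 4 / 100) := by
    rw [abs_mul, abs_of_pos (by linarith : 0 < α)]
    gcongr
  have : (Real.sin x / x) ^ α - (1 - α * x ^ 2 / 6) =
      ((Real.sin x / x) ^ α - (1 + α * y)) + α * r := by rw [hr, hy]; ring
  rw [this]
  refine (abs_add_le _ _).trans ?_
  have : 0 ≤ x ^ 4 := by positivity
  linarith

/-- The weighted sum of exponentials left over once `(1 - e^{-iθ})^α` is symmetrised. -/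
noncomputable def expSum (α θ : ℝ) : ℂ :=
  muOne α * Complex.exp (((1 - α / 2) * θ : ℝ) * Complex.I) +
    muZero α * Complex.exp ((-(α / 2) * θ : ℝ) * Complex.I) +
    muNegOne α * Complex.exp (((-1 - α / 2) * θ : ℝ) * Complex.I)

/-- The weights `μ_p` at the points `p - α/2` have total mass `1`, vanishing first and third
moments, and second moment `1/3 - α²/12`; only a fourth-order remainder is left. -/
lemma norm_expSum_sub_le {α θ : ℝ} (hα₁ : 1 < α) (hα₂ : α < 2) (h0 : 0 < θ) (h1 : θ ≤ 1 / 2) :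
    ‖expSum α θ - (1 - (1 / 3 - α ^ 2 / 12) * θ ^ 2 / 2 : ℝ)‖ ≤
      (|muOne α| + |muZero α| + |muNegOne α|) * (16 * θ ^ 4) := by
  -- All three frequencies satisfy `|c| ≤ 2`; hence `θ ≤ 1/2` and the factor `16 = 2^4`.
  have key : ∀ c : ℝ, |c| ≤ 2 → ‖Complex.exp ((c * θ : ℝ) * Complex.I) -
      (1 + (c * θ : ℝ) * Complex.I - (c * θ : ℝ) ^ 2 / 2 - (c * θ : ℝ) ^ 3 / 6 * Complex.I)‖ ≤
        16 * θ ^ 4 := fun c hc => by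
    have hb : |c * θ| ≤ 2 * θ := by rw [abs_mul, abs_of_pos h0]; gcongr
    refine (norm_exp_mul_I_sub_taylor_le (hb.trans (by linarith))).trans ?_
    calc (c * θ) ^ 4 = |c * θ| ^ 4 := by rw [(show Even 4 by decide).pow_abs]
      _ ≤ (2 * θ) ^ 4 := by gcongr
      _ = _ := by ring
  have k1 := key (1 - α / 2) (by rw [abs_le]; constructor <;> linarith)
  have k2 := key (-(α / 2)) (by rw [abs_le]; constructor <;> linarith)
  have k3 := key (-1 - α / 2) (by rw [abs_le]; constructor <;> linarith)
  have e : expSum α θ - (1 - (1 / 3 - α ^ 2 / 12) * θ ^ 2 / 2 : ℝ) =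
      muOne α * (Complex.exp (((1 - α / 2) * θ : ℝ) * Complex.I) -
      (1 + ((1 - α / 2) * θ : ℝ) * Complex.I - ((1 - α / 2) * θ : ℝ) ^ 2 / 2
        - ((1 - α / 2) * θ : ℝ) ^ 3 / 6 * Complex.I)) +
      muZero α * (Complex.exp ((-(α / 2) * θ : ℝ) * Complex.I) -
      (1 + (-(α / 2) * θ : ℝ) * Complex.I - (-(α / 2) * θ : ℝ) ^ 2 / 2
        - (-(α / 2) * θ : ℝ) ^ 3 / 6 * Complex.I)) +
      muNegOne α * (Complex.exp (((-1 - α / 2) * θ : ℝ) * Complex.I) -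
      (1 + ((-1 - α / 2) * θ : ℝ) * Complex.I - ((-1 - α / 2) * θ : ℝ) ^ 2 / 2
        - ((-1 - α / 2) * θ : ℝ) ^ 3 / 6 * Complex.I)) := by
    unfold expSum muOne muZero muNegOne
    push_cast
    ring
  rw [e]
  refine (norm_add₃_le).trans ?_
  simp only [norm_mul, Complex.norm_real, Real.norm_eq_abs, add_mul]
  gcongr

lemma norm_expSum_le (α θ : ℝ) : ‖expSum α θ‖ ≤ |muOne α| + |muZero α| + |muNegOne α| := by
  unfold expSum
  refine (norm_add₃_le).trans ?_
  simp only [norm_mul, Complex.norm_real, Real.norm_eq_abs, Complex.norm_exp_ofReal_mul_I, mul_one,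
    le_refl]

lemma errSymbol_eq {α θ : ℝ} (h0 : 0 < θ) (h1 : θ ≤ 1) :
    errSymbol α θ = (θ * Complex.I) ^ (α : ℂ) * ((1 + bTwo α * (2 * Real.cos θ - 2) : ℝ) -
      ((Real.sin (θ / 2) / (θ / 2)) ^ α : ℝ) * expSum α θ) := by
  have h : ∀ p : ℝ, Complex.exp (((p - α / 2) * θ : ℝ) * Complex.I) =
      Complex.exp (-(α * θ / 2 * Complex.I)) * Complex.exp (p * (θ * Complex.I)) := fun p => by
    rw [← Complex.exp_add]
    congr 1
    push_cast
    ring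
  have h1' := h 1
  have h2' := h 0
  have h3' := h (-1)
  simp only [Complex.ofReal_one, Complex.ofReal_neg, neg_mul, one_mul] at h1' h3'
  rw [zero_sub, Complex.ofReal_zero, zero_mul, Complex.exp_zero, mul_one] at h2'
  unfold errSymbol glSymbol expSum
  rw [one_sub_exp_neg_cpow h0 h1, h1', h2', h3']
  ring

/-- The choice of `bTwo` is exactly the cancellation of `θ²`: `α/24` from the sinc power plus `(1/3
- α²/12)/2` from `expSum` equals `(4 + α - α²)/24`. -/
lemma norm_errSymbol_small {α : ℝ} (hα₁ : 1 < α) (hα₂ : α < 2) :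
    ∃ C : ℝ, 0 ≤ C ∧ ∀ θ : ℝ, 0 < θ → θ ≤ 1 / 2 → ‖errSymbol α θ‖ ≤ C * (θ ^ α * θ ^ 4) := by
  set M := |muOne α| + |muZero α| + |muNegOne α| with hM
  have hM0 : 0 ≤ M := by positivity
  refine ⟨2 * |bTwo α| + M + 16 * M + 1, by positivity, fun θ h0 h1 => ?_⟩
  rw [errSymbol_eq h0 (by linarith), norm_mul]
  have hn : ‖((θ : ℂ) * Complex.I) ^ (α : ℂ)‖ = θ ^ α := by
    rw [norm_ofReal_mul_I_cpow (by linarith), abs_of_pos h0]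
  rw [hn, mul_left_comm]
  refine mul_le_mul_of_nonneg_left ?_ (by positivity)
  obtain ⟨S, hS⟩ : ∃ S, S = (Real.sin (θ / 2) / (θ / 2)) ^ α := ⟨_, rfl⟩
  have b1 := abs_sinc_rpow_sub_le hα₁ hα₂ (x := θ / 2) (by linarith) (by linarith)
  have b2 := norm_expSum_sub_le hα₁ hα₂ h0 h1
  have b3 := Real.cos_bound (x := θ) (by rw [abs_of_pos h0]; linarith)
  have b4 := norm_expSum_le α θ
  rw [abs_of_pos h0] at b3
  rw [← hS] at b1 ⊢
  obtain ⟨m, hm⟩ : ∃ m, m = 1 / 3 - α ^ 2 / 12 := ⟨_, rfl⟩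
  have hm1 : |m| ≤ 1 := by rw [abs_le, hm]; constructor <;> nlinarith
  -- Three Taylor remainders, and `αm/48 θ⁴` as the product of the two quadratic terms.
  have e : ((1 + bTwo α * (2 * Real.cos θ - 2) : ℝ) : ℂ) - S * expSum α θ =
      ((2 * bTwo α * (Real.cos θ - (1 - θ ^ 2 / 2)) : ℝ) : ℂ) -
      ((S - (1 - α * (θ / 2) ^ 2 / 6) : ℝ) : ℂ) * expSum α θ -
      ((1 - α * (θ / 2) ^ 2 / 6 : ℝ) : ℂ) *
        (expSum α θ - (1 - (1 / 3 - α ^ 2 / 12) * θ ^ 2 / 2 : ℝ)) -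
      ((α * m / 48 * θ ^ 4 : ℝ) : ℂ) := by
    rw [hm]
    unfold bTwo
    push_cast
    ring
  rw [e]
  have hθ4 : 0 ≤ θ ^ 4 := by positivity
  have t1 : ‖((2 * bTwo α * (Real.cos θ - (1 - θ ^ 2 / 2)) : ℝ) : ℂ)‖ ≤
      2 * |bTwo α| * θ ^ 4 := by
    rw [Complex.norm_real, Real.norm_eq_abs, abs_mul, abs_mul, abs_two]
    gcongr
    linarith
  have t2 : ‖((S - (1 - α * (θ / 2) ^ 2 / 6) : ℝ) : ℂ) * expSum α θ‖ ≤ θ ^ 4 * M := by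
    rw [norm_mul, Complex.norm_real, Real.norm_eq_abs]
    gcongr
    refine b1.trans ?_
    rw [div_pow]
    exact div_le_self hθ4 (by norm_num)
  have t3 : ‖((1 - α * (θ / 2) ^ 2 / 6 : ℝ) : ℂ) *
        (expSum α θ - (1 - (1 / 3 - α ^ 2 / 12) * θ ^ 2 / 2 : ℝ))‖ ≤ 1 * (M * (16 * θ ^ 4)) := by
    rw [norm_mul, Complex.norm_real, Real.norm_eq_abs]
    gcongr
    have : α * (θ / 2) ^ 2 ≤ 2 * (1 / 4) ^ 2 :=
      mul_le_mul hα₂.le (pow_le_pow_left₀ (by linarith) (by linarith) 2) (by positivity)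
        (by norm_num)
    have : 0 ≤ α * (θ / 2) ^ 2 := by positivity
    rw [abs_le]
    constructor <;> linarith
  have t4 : ‖((α * m / 48 * θ ^ 4 : ℝ) : ℂ)‖ ≤ 1 * θ ^ 4 := by
    rw [Complex.norm_real, Real.norm_eq_abs, abs_mul, abs_of_nonneg hθ4]
    gcongr
    rw [abs_div, abs_mul, abs_of_pos (by linarith : 0 < α), abs_of_pos (by norm_num : (0:ℝ) < 48)]
    nlinarith [abs_nonneg m]
  refine (norm_sub_le _ _).trans ?_
  refine (add_le_add_left (norm_sub_le _ _) _).trans ?_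
  refine (add_le_add_left (add_le_add_left (norm_sub_le _ _) _) _).trans ?_
  linarith

lemma errSymbol_zero {α : ℝ} (hα : α ≠ 0) : errSymbol α 0 = 0 := by
  simp [errSymbol, glSymbol, hα]

/-- The symbol at `-θ` is the complex conjugate: both bases have nonnegative real part, so
conjugation commutes with the powers. -/
lemma errSymbol_neg (α θ : ℝ) : ‖errSymbol α (-θ)‖ = ‖errSymbol α θ‖ := by
  by_cases h0 : θ = 0
  · simp [h0]
  have h1 : (-(θ * Complex.I)) ^ (α : ℂ) = (starRingEnd ℂ) ((θ * Complex.I) ^ (α : ℂ)) := by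
    have := Complex.conj_cpow (θ * Complex.I) α (by
      intro h
      rw [Complex.arg_eq_pi_iff] at h
      simp at h)
    simpa using this
  have h2 : (1 - Complex.exp (θ * Complex.I)) ^ (α : ℂ) =
      (starRingEnd ℂ) ((1 - Complex.exp (-(θ * Complex.I))) ^ (α : ℂ)) := by
    have := Complex.conj_cpow (1 - Complex.exp (-(θ * Complex.I))) α (by
      intro h
      rw [Complex.arg_eq_pi_iff] at h
      have h3 : Real.cos θ ≤ 1 := Real.cos_le_one θ
      simp [Complex.exp_re] at h
      linarith [h.1])
    simpa [← Complex.exp_conj] using this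
  have : errSymbol α (-θ) = (starRingEnd ℂ) (errSymbol α θ) := by
    unfold errSymbol glSymbol
    simp only [Complex.ofReal_neg, neg_mul, neg_neg, h1, h2, map_sub, map_mul, map_add,
      Complex.conj_ofReal, ← Complex.exp_conj, map_neg, Complex.conj_I, mul_neg, Real.cos_neg]
  rw [this, RCLike.norm_conj]

lemma norm_one_sub_exp_cpow_le {α : ℝ} (hα : 0 < α) (θ : ℝ) :
    ‖(1 - Complex.exp (-(θ * Complex.I))) ^ (α : ℂ)‖ ≤ 2 ^ α := by
  have hn : ‖1 - Complex.exp (-(θ * Complex.I))‖ ≤ 2 := by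
    refine (norm_sub_le _ _).trans ?_
    rw [← neg_mul, ← Complex.ofReal_neg, Complex.norm_exp_ofReal_mul_I]
    norm_num
  by_cases h0 : 1 - Complex.exp (-(θ * Complex.I)) = 0
  · rw [h0, Complex.zero_cpow (by simpa using hα.ne')]
    simp
    positivity
  · rw [Complex.norm_cpow_of_ne_zero h0]
    simp
    gcongr

lemma norm_glSymbol_le {α : ℝ} (hα : 0 < α) (θ : ℝ) :
    ‖glSymbol α θ‖ ≤ 2 ^ α * (|muOne α| + |muZero α| + |muNegOne α|) := by
  unfold glSymbol
  rw [norm_mul]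
  gcongr
  · exact norm_one_sub_exp_cpow_le hα θ
  · refine (norm_add₃_le).trans ?_
    rw [← neg_mul, ← Complex.ofReal_neg]
    simp only [norm_mul, Complex.norm_real, Real.norm_eq_abs, Complex.norm_exp_ofReal_mul_I,
      mul_one, le_refl]

/-- Beyond `θ = 1/2` no cancellation is needed: `glSymbol` is bounded, the other term is `O(θ^α)`,
and `θ^(α+4) ≥ 1/64`. Negative `θ` follows by symmetry. -/
lemma norm_errSymbol_le {α : ℝ} (hα₁ : 1 < α) (hα₂ : α < 2) :
    ∃ C : ℝ, 0 ≤ C ∧ ∀ θ : ℝ, ‖errSymbol α θ‖ ≤ C * (|θ| ^ α * θ ^ 4) := by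
  obtain ⟨C, hC, hs⟩ := norm_errSymbol_small hα₁ hα₂
  set M := |muOne α| + |muZero α| + |muNegOne α| with hM
  have hα : 0 < α := by linarith
  set D := 16 * (1 + |bTwo α| * 4) + 64 * 4 * M with hD
  refine ⟨C + D, by positivity, ?_⟩
  have hpos : ∀ θ : ℝ, 0 < θ → ‖errSymbol α θ‖ ≤ (C + D) * (|θ| ^ α * θ ^ 4) := fun θ h0 => by
    rw [abs_of_pos h0]
    have hp : 0 ≤ θ ^ α * θ ^ 4 := by positivity
    by_cases h1 : θ ≤ 1 / 2
    · exact (hs θ h0 h1).trans (by gcongr; exact le_add_of_nonneg_right (by positivity))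
    · push Not at h1
      have h16 : 1 ≤ 16 * θ ^ 4 := by
        have : (1 / 2 : ℝ) ^ 4 ≤ θ ^ 4 := by gcongr
        linarith
      have h2 : (1 : ℝ) ≤ (2 * θ) ^ α := Real.one_le_rpow (by linarith) hα.le
      have h24 : (2 : ℝ) ^ α ≤ 4 := by
        calc (2 : ℝ) ^ α ≤ 2 ^ (2 : ℝ) := Real.rpow_le_rpow_of_exponent_le (by norm_num) hα₂.le
          _ = 4 := by norm_num
      have h3 : 1 ≤ 4 * θ ^ α := by
        rw [Real.mul_rpow (by norm_num) h0.le] at h2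
        exact h2.trans (by gcongr)
      have h4 : (1 : ℝ) ≤ 64 * (θ ^ α * θ ^ 4) := by
        calc (1 : ℝ) ≤ (4 * θ ^ α) * (16 * θ ^ 4) := one_le_mul_of_one_le_of_one_le h3 h16
          _ = _ := by ring
      have t1 : ‖((θ : ℂ) * Complex.I) ^ (α : ℂ) *
          (1 + bTwo α * (2 * Real.cos θ - 2) : ℝ)‖ ≤
          (θ ^ α * (16 * θ ^ 4)) * (1 + |bTwo α| * 4) := by
        rw [norm_mul, norm_ofReal_mul_I_cpow hα.ne', Complex.norm_real, Real.norm_eq_abs,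
          abs_of_pos h0]
        gcongr
        · exact le_mul_of_one_le_right (by positivity) h16
        · refine (abs_add_le _ _).trans ?_
          rw [abs_one, abs_mul]
          gcongr
          have := Real.neg_one_le_cos θ
          have := Real.cos_le_one θ
          rw [abs_le]
          constructor <;> linarith
      have t2 : ‖glSymbol α θ‖ ≤ 4 * M * (64 * (θ ^ α * θ ^ 4)) := by
        refine (norm_glSymbol_le hα θ).trans ?_
        calc 2 ^ α * M ≤ 4 * M * 1 := by rw [mul_one]; gcongr
          _ ≤ _ := by gcongr
      refine (norm_sub_le _ _).trans ((add_le_add t1 t2).trans ?_)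
      rw [hD]
      nlinarith [mul_nonneg hC hp]
  intro θ
  rcases lt_trichotomy θ 0 with h | h | h
  · have := hpos (-θ) (by linarith)
    rwa [errSymbol_neg, abs_neg, (show Even 4 by decide).neg_pow] at this
  · subst h
    simp [errSymbol_zero hα.ne']
  · exact hpos θ h

/-! ### Laplace transform of `t^(a-1)` at complex arguments. -/

/-- The measure `t^(a-1) dt` on the half line. -/
noncomputable def powerMeasure (a : ℝ) : Measure ℝ :=
  (volume.restrict (Ioi 0)).withDensity (fun t => ENNReal.ofReal (t ^ (a - 1)))

lemma measurable_ofReal_rpow (s : ℝ) : Measurable (fun t : ℝ => ENNReal.ofReal (t ^ s)) := by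
  fun_prop

lemma complexMGF_powerMeasure (a : ℝ) (z : ℂ) :
    ProbabilityTheory.complexMGF id (powerMeasure a) z =
      ∫ t in Ioi (0 : ℝ), ((t ^ (a - 1) : ℝ) : ℂ) * Complex.exp (z * t) := by
  unfold ProbabilityTheory.complexMGF powerMeasure
  rw [integral_withDensity_eq_integral_toReal_smul (measurable_ofReal_rpow _)
    (ae_of_all _ fun _ => ENNReal.ofReal_lt_top)]
  refine setIntegral_congr_fun measurableSet_Ioi fun t ht => ?_
  have : 0 ≤ t ^ (a - 1) := Real.rpow_nonneg (le_of_lt ht) _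
  simp [ENNReal.toReal_ofReal this]

lemma integrableOn_rpow_mul_exp {a : ℝ} (ha : 0 < a) {b : ℝ} (hb : 0 < b) :
    IntegrableOn (fun t : ℝ => t ^ (a - 1) * Real.exp (-(b * t))) (Ioi 0) := by
  have := integrableOn_rpow_mul_exp_neg_mul_rpow (s := a - 1) (by linarith) one_pos hb
  simpa using this

lemma Iio_subset_interior_integrableExpSet {a : ℝ} (ha : 0 < a) :
    Iio 0 ⊆ interior (ProbabilityTheory.integrableExpSet id (powerMeasure a)) := by
  refine interior_maximal (fun x hx => ?_) isOpen_Iio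
  have hx : x < 0 := hx
  show Integrable (fun t : ℝ => Real.exp (x * id t)) (powerMeasure a)
  unfold powerMeasure
  rw [integrable_withDensity_iff (measurable_ofReal_rpow _)
    (ae_of_all _ fun _ => ENNReal.ofReal_lt_top)]
  refine (integrableOn_rpow_mul_exp ha (b := -x) (by linarith)).congr_fun (fun t ht => ?_)
    measurableSet_Ioi
  have : 0 ≤ t ^ (a - 1) := Real.rpow_nonneg (le_of_lt ht) _
  simp [ENNReal.toReal_ofReal this, mul_comm]

/-- With `z = -r`, both sides are analytic on `Re z < 0` and agree on the negative reals, where this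
is the Gamma integral; the identity theorem does the rest. -/
lemma integral_rpow_mul_cexp_neg_mul {a : ℝ} (ha : 0 < a) {r : ℂ} (hr : 0 < r.re) :
    ∫ t in Ioi (0 : ℝ), ((t ^ (a - 1) : ℝ) : ℂ) * Complex.exp (-(r * t)) =
      (1 / r) ^ (a : ℂ) * Real.Gamma a := by
  have h1 : AnalyticOnNhd ℂ (ProbabilityTheory.complexMGF id (powerMeasure a)) {z | z.re < 0} :=
    ProbabilityTheory.analyticOnNhd_complexMGF.mono fun z hz =>
      Iio_subset_interior_integrableExpSet ha hz
  have ho : IsOpen {z : ℂ | z.re < 0} := isOpen_lt Complex.continuous_re continuous_const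
  have h2 : AnalyticOnNhd ℂ (fun z : ℂ => (1 / (-z)) ^ (a : ℂ) * Real.Gamma a) {z | z.re < 0} := by
    refine DifferentiableOn.analyticOnNhd (fun z hz => ?_) ho
    have hz : z.re < 0 := hz
    have hz0 : -z ≠ 0 := fun h => by
      rw [neg_eq_zero] at h
      simp [h] at hz
    refine DifferentiableAt.differentiableWithinAt ?_
    refine DifferentiableAt.mul_const
      (DifferentiableAt.cpow_const (by fun_prop (disch := exact hz0)) ?_) _
    rw [Complex.mem_slitPlane_iff]
    left
    rw [one_div, Complex.inv_re]
    refine div_pos (by simpa using hz) (Complex.normSq_pos.mpr hz0)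
  have heq := AnalyticOnNhd.eqOn_of_preconnected_of_frequently_eq h1 h2
    (convex_halfSpace_re_lt 0).isPreconnected (z₀ := -1) (by simp) ?_
  · have := heq (x := -r) (by simpa using hr)
    rw [complexMGF_powerMeasure] at this
    simpa using this
  · have hreal : ∀ x : ℝ, x < 0 → ProbabilityTheory.complexMGF id (powerMeasure a) x =
        (1 / (-(x : ℂ))) ^ (a : ℂ) * Real.Gamma a := fun x hx => by
      rw [complexMGF_powerMeasure]
      have := Complex.integral_cpow_mul_exp_neg_mul_Ioi (a := a) (r := -x) (by simpa using ha)
        (by linarith)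
      rw [Complex.Gamma_ofReal] at this
      push_cast at this
      rw [← this]
      refine setIntegral_congr_fun measurableSet_Ioi fun t ht => ?_
      rw [Complex.ofReal_cpow (le_of_lt ht)]
      simp
    rw [Filter.frequently_iff]
    intro U hU
    have hU' : U ∈ nhdsWithin (-1 : ℂ) {-1}ᶜ := hU
    -- Negative reals, distinct from `-1`, accumulating at `-1`.
    have ht : Filter.Tendsto (fun n : ℕ => (((-1 - 1 / ((n : ℝ) + 1) : ℝ)) : ℂ)) Filter.atTop
        (nhdsWithin (-1 : ℂ) {-1}ᶜ) := by
      rw [tendsto_nhdsWithin_iff]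
      constructor
      · have h := (tendsto_one_div_add_atTop_nhds_zero_nat (𝕜 := ℝ)).const_sub (-1)
        have := (Complex.continuous_ofReal.tendsto _).comp h
        simpa [Function.comp_def] using this
      · refine Filter.Eventually.of_forall fun n => ?_
        simp
        norm_cast
    obtain ⟨n, hn⟩ := (ht.eventually hU').exists
    refine ⟨_, hn, hreal _ ?_⟩
    have : 0 < 1 / ((n : ℝ) + 1) := by positivity
    linarith

/-! ### Decay of the transform and Fourier inversion. -/

lemma iteratedDeriv_ofReal_comp {u : ℝ → ℝ} {n : ℕ} (hu : ContDiff ℝ n u) (x : ℝ) :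
    iteratedDeriv n (fun y => (u y : ℂ)) x = (iteratedDeriv n u x : ℝ) := by
  have := Complex.ofRealCLM.iteratedFDeriv_comp_left (x := x) (f := u) (n := n) hu.contDiffAt
    (i := n) le_rfl
  simp only [iteratedDeriv_eq_iteratedFDeriv]
  rw [show (fun y => (u y : ℂ)) = Complex.ofRealCLM ∘ u from rfl, this]
  rfl

/-- The function `φ` with `u x = ∫ φ w e^{-2πiwx} dw`. -/
noncomputable def spec (u : ℝ → ℝ) : ℝ → ℂ := 𝓕⁻ (fun x => (u x : ℂ))

lemma norm_fourier_le (f : ℝ → ℂ) (w : ℝ) : ‖𝓕 f w‖ ≤ ∫ v, ‖f v‖ :=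
  VectorFourier.norm_fourierIntegral_le_integral_norm _ _ _ _ _

lemma continuous_spec {u : ℝ → ℝ} (hu : Integrable u) : Continuous (spec u) := by
  have h : Continuous (𝓕 (fun x => (u x : ℂ))) :=
    VectorFourier.fourierIntegral_continuous Real.continuous_fourierChar (by fun_prop) hu.ofReal
  have : spec u = fun w => 𝓕 (fun x => (u x : ℂ)) (-w) := by
    ext w
    exact Real.fourierInv_eq_fourier_neg _ _
  rw [this]
  exact h.comp continuous_neg

lemma SmoothIntegrable.integrable {u : ℝ → ℝ} (hu : SmoothIntegrable u) : Integrable u := by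
  simpa using hu.2 0 (by norm_num)

/-- The transform of the seventh derivative carries the factor `(2πw)^7` in modulus, and a transform
is bounded by the `L¹` norm. -/
lemma spec_decay {u : ℝ → ℝ} (hu : SmoothIntegrable u) :
    ∃ C : ℝ, ∀ w : ℝ, ‖spec u w‖ ≤ C ∧ |w| ^ 7 * ‖spec u w‖ ≤ C := by
  have hle : ∀ k : ℕ, k ≤ 7 → ContDiff ℝ k u := fun k hk => hu.1.of_le (by exact_mod_cast hk)
  have hf := Real.fourier_iteratedDeriv (f := fun x => (u x : ℂ)) (N := 7) (n := 7)
    (Complex.ofRealCLM.contDiff.comp hu.1) (fun n hn => by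
      have hn : n ≤ 7 := by exact_mod_cast hn
      have : iteratedDeriv n (fun x => (u x : ℂ)) = fun x => ((iteratedDeriv n u x : ℝ) : ℂ) :=
        funext fun x => iteratedDeriv_ofReal_comp (hle n hn) x
      rw [this]
      exact (hu.2 n hn).ofReal) le_rfl
  refine ⟨max (∫ v, ‖(u v : ℂ)‖) (∫ v, ‖iteratedDeriv 7 (fun x => (u x : ℂ)) v‖), fun w => ⟨?_, ?_⟩⟩
  · rw [spec, Real.fourierInv_eq_fourier_neg]
    exact (norm_fourier_le _ _).trans (le_max_left _ _)
  · refine le_trans ?_ ((norm_fourier_le _ (-w)).trans (le_max_right _ _))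
    rw [hf]
    simp only [spec, Real.fourierInv_eq_fourier_neg, norm_smul]
    gcongr
    simp only [norm_pow, norm_mul, Complex.norm_real, Complex.norm_I, norm_neg, Real.norm_eq_abs,
      Complex.ofReal_neg, mul_one, Complex.norm_two]
    gcongr
    rw [abs_of_pos Real.pi_pos]
    refine le_mul_of_one_le_left (abs_nonneg _) ?_
    linarith [Real.pi_gt_three]

lemma integrable_of_integrableOn_Ioi_comp_neg {f : ℝ → ℝ} (h : IntegrableOn f (Ioi 0))
    (h' : IntegrableOn (fun x => f (-x)) (Ioi 0)) : Integrable f := by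
  have h2 : IntegrableOn f (Iio 0) := by
    have := h'.comp_neg
    simpa using this
  rw [← integrableOn_univ, ← Iio_union_Ici (a := (0 : ℝ))]
  exact h2.union (Iff.mpr integrableOn_Ici_iff_integrableOn_Ioi h)

/-- Boundedness of `spec u` with `s > -1` controls the origin; the majorant `|w|^(s-7)` with `s < 6`
controls infinity. Negative `s` serves the fractional integral, `s = α + 4` the error. -/
lemma integrable_rpow_mul_spec {u : ℝ → ℝ} (hu : SmoothIntegrable u) {s : ℝ} (hs₁ : -1 < s)
    (hs₂ : s < 6) : Integrable (fun w => |w| ^ s * ‖spec u w‖) := by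
  obtain ⟨C, hC⟩ := spec_decay hu
  have hm : Measurable (fun w => |w| ^ s * ‖spec u w‖) :=
    (measurable_norm.pow_const s).mul (continuous_spec hu.integrable).measurable.norm
  have key : ∀ g : ℝ → ℝ, Measurable g → (∀ w, 0 < w → 0 ≤ g w ∧ g w ≤ C ∧ w ^ 7 * g w ≤ C) →
      IntegrableOn (fun w => w ^ s * g w) (Ioi 0) := by
    intro g hg hb
    have hm : Measurable (fun w : ℝ => w ^ s * g w) := (measurable_id.pow_const s).mul hg
    rw [← Ioc_union_Ioi_eq_Ioi (zero_le_one (α := ℝ))]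
    refine IntegrableOn.union ?_ ?_
    · have := (intervalIntegrable_iff_integrableOn_Ioc_of_le zero_le_one).mp
        (intervalIntegral.intervalIntegrable_rpow' (a := 0) (b := 1) hs₁)
      refine Integrable.mono' (this.mul_const C) hm.aestronglyMeasurable ?_
      filter_upwards [ae_restrict_mem measurableSet_Ioc] with w hw
      have hws : 0 ≤ w ^ s := Real.rpow_nonneg hw.1.le _
      rw [Real.norm_of_nonneg (mul_nonneg hws (hb w hw.1).1)]
      exact mul_le_mul_of_nonneg_left (hb w hw.1).2.1 hws
    · have := integrableOn_Ioi_rpow_of_lt (a := s - 7) (c := 1) (by linarith) one_pos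
      refine Integrable.mono' (this.mul_const C) hm.aestronglyMeasurable ?_
      filter_upwards [ae_restrict_mem measurableSet_Ioi] with w hw
      have hw0 : 0 < w := zero_lt_one.trans hw
      have hws : 0 ≤ w ^ (s - 7) := Real.rpow_nonneg hw0.le _
      rw [Real.norm_of_nonneg (mul_nonneg (Real.rpow_nonneg hw0.le _) (hb w hw0).1)]
      have : w ^ s = w ^ (s - 7) * w ^ 7 := by
        rw [← Real.rpow_natCast, ← Real.rpow_add hw0]
        norm_num
      rw [this, mul_assoc]
      exact mul_le_mul_of_nonneg_left (hb w hw0).2.2 hws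
  have hsm := (continuous_spec hu.integrable).measurable.norm
  refine integrable_of_integrableOn_Ioi_comp_neg ?_ ?_
  · refine (key _ hsm fun w hw => ⟨norm_nonneg _, (hC w).1, ?_⟩).congr_fun (fun w hw => ?_)
      measurableSet_Ioi
    · simpa [abs_of_pos hw] using (hC w).2
    · simp only [abs_of_pos (show 0 < w from hw)]
  · refine (key (fun w => ‖spec u (-w)‖) (hsm.comp measurable_neg)
      fun w hw => ⟨norm_nonneg _, (hC _).1, ?_⟩).congr_fun (fun w hw => ?_) measurableSet_Ioi
    · simpa [abs_of_pos hw] using (hC (-w)).2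
    · simp only [abs_neg, abs_of_pos (show 0 < w from hw)]

lemma integrable_mul_spec {u : ℝ → ℝ} (hu : SmoothIntegrable u) {s K : ℝ} (hs₁ : -1 < s)
    (hs₂ : s < 6) {m : ℝ → ℂ} (hm : Measurable m) (hb : ∀ w, w ≠ 0 → ‖m w‖ ≤ K * |w| ^ s) :
    Integrable (fun w => m w * spec u w) := by
  refine Integrable.mono' ((integrable_rpow_mul_spec hu hs₁ hs₂).const_mul K)
    (hm.mul (continuous_spec hu.integrable).measurable).aestronglyMeasurable ?_
  filter_upwards [compl_mem_ae_iff.mpr (measure_singleton (0 : ℝ))] with w hw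
  rw [norm_mul, ← mul_assoc]
  exact mul_le_mul_of_nonneg_right (hb w hw) (norm_nonneg _)

lemma integrable_spec {u : ℝ → ℝ} (hu : SmoothIntegrable u) : Integrable (spec u) := by
  simpa using integrable_mul_spec hu (s := 0) (K := 1) (m := fun _ => 1) (by norm_num)
    (by norm_num) measurable_const (by simp)

lemma fourier_spec {u : ℝ → ℝ} (hu : SmoothIntegrable u) : 𝓕 (spec u) = fun x => (u x : ℂ) := by
  refine Continuous.fourier_fourierInv_eq (Complex.continuous_ofReal.comp hu.1.continuous)
    hu.integrable.ofReal ?_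
  have := (integrable_spec hu).comp_neg
  refine this.congr (ae_of_all _ fun w => ?_)
  simp [spec, Real.fourierInv_eq_fourier_neg]

lemma eq_integral_spec {u : ℝ → ℝ} (hu : SmoothIntegrable u) (x : ℝ) :
    (u x : ℂ) = ∫ w : ℝ, Complex.exp ((-2 * Real.pi * w * x : ℝ) * Complex.I) * spec u w := by
  rw [← congrFun (fourier_spec hu) x, Real.fourier_real_eq_integral_exp_smul]
  rfl

lemma abs_le_of_smoothIntegrable {u : ℝ → ℝ} (hu : SmoothIntegrable u) (x : ℝ) :
    |u x| ≤ ∫ w, ‖spec u w‖ := by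
  have := norm_fourier_le (spec u) x
  rw [fourier_spec hu] at this
  simpa using this

/-! ### The symbol of the fractional integral. -/

/-- The Fourier symbol of `d/dx`, for the kernel `e^{-2πiwx}`. -/
noncomputable def zeta (w : ℝ) : ℂ := ((-2 * Real.pi * w : ℝ) : ℂ) * Complex.I

lemma continuous_zeta : Continuous zeta := by
  unfold zeta
  fun_prop

lemma measurable_zeta_cpow (c : ℂ) : Measurable (fun w => zeta w ^ c) :=
  continuous_zeta.measurable.pow_const c

lemma norm_zeta (w : ℝ) : ‖zeta w‖ = 2 * Real.pi * |w| := by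
  simp [zeta, abs_of_pos Real.pi_pos]

lemma norm_zeta_cpow (w s : ℝ) : ‖zeta w ^ (s : ℂ)‖ = (2 * Real.pi) ^ s * |w| ^ s := by
  rw [Complex.norm_cpow_real, norm_zeta, Real.mul_rpow (by positivity) (abs_nonneg _)]

lemma integrableOn_rpow_mul_comp_sub {a : ℝ} (ha₀ : 0 < a) (ha₁ : a < 1) {u : ℝ → ℝ}
    (hu : SmoothIntegrable u) (x : ℝ) :
    IntegrableOn (fun t => t ^ (a - 1) * u (x - t)) (Ioi 0) := by
  have hc : Continuous fun t => u (x - t) := hu.1.continuous.comp (by fun_prop)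
  have hm : Measurable fun t : ℝ => t ^ (a - 1) * u (x - t) :=
    (measurable_id.pow_const _).mul hc.measurable
  rw [← Ioc_union_Ioi_eq_Ioi (zero_le_one (α := ℝ))]
  refine IntegrableOn.union ?_ ?_
  · have := (intervalIntegrable_iff_integrableOn_Ioc_of_le zero_le_one).mp
      (intervalIntegral.intervalIntegrable_rpow' (a := 0) (b := 1) (r := a - 1) (by linarith))
    refine Integrable.mono' (this.mul_const (∫ w, ‖spec u w‖)) hm.aestronglyMeasurable ?_
    filter_upwards [ae_restrict_mem measurableSet_Ioc] with t ht
    rw [norm_mul, Real.norm_of_nonneg (Real.rpow_nonneg ht.1.le _)]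
    exact mul_le_mul_of_nonneg_left (abs_le_of_smoothIntegrable hu _)
      (Real.rpow_nonneg ht.1.le _)
  · have h1 : Integrable fun t => u (x - t) := hu.integrable.comp_sub_left x
    refine Integrable.mono' h1.norm.integrableOn hm.aestronglyMeasurable ?_
    filter_upwards [ae_restrict_mem measurableSet_Ioi] with t ht
    have ht0 : 0 < t := zero_lt_one.trans ht
    rw [norm_mul, Real.norm_of_nonneg (Real.rpow_nonneg ht0.le _)]
    exact mul_le_of_le_one_left (norm_nonneg _)
      (Real.rpow_le_one_of_one_le_of_nonpos (le_of_lt ht) (by linarith))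

/-- Damping makes the kernel integrable, so Fubini applies; the inner integral is the Laplace
transform at `ε + ζ`, whose real part is `ε > 0`. -/
lemma integral_damped_eq {a : ℝ} (ha₀ : 0 < a) {u : ℝ → ℝ} (hu : SmoothIntegrable u) (x : ℝ)
    {ε : ℝ} (hε : 0 < ε) :
    ∫ t in Ioi (0 : ℝ), ((t ^ (a - 1) * Real.exp (-(ε * t)) : ℝ) : ℂ) * u (x - t) =
      Real.Gamma a * ∫ w : ℝ, (1 / (ε + zeta w)) ^ (a : ℂ) *
        (Complex.exp ((-2 * Real.pi * w * x : ℝ) * Complex.I) * spec u w) := by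
  have h1 : ∀ t : ℝ, ((t ^ (a - 1) * Real.exp (-(ε * t)) : ℝ) : ℂ) * u (x - t) =
      ∫ w : ℝ, Complex.exp ((-2 * Real.pi * w * (x - t) : ℝ) * Complex.I) *
        (((t ^ (a - 1) * Real.exp (-(ε * t)) : ℝ) : ℂ) * spec u w) := fun t => by
    rw [eq_integral_spec hu, ← integral_const_mul]
    congr 1
    ext w
    ring
  simp_rw [h1]
  rw [integral_integral_swap]
  · rw [← integral_const_mul]
    congr 1
    ext w
    have h2 := integral_rpow_mul_cexp_neg_mul ha₀ (r := ε + zeta w) (by simpa [zeta] using hε)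
    rw [mul_left_comm, ← mul_assoc, ← mul_assoc, ← h2, ← integral_mul_const, ← integral_mul_const]
    congr 1
    ext t
    have : Complex.exp ((-2 * Real.pi * w * (x - t) : ℝ) * Complex.I) *
        Complex.exp (-(ε * t)) = Complex.exp (-((ε + zeta w) * t)) *
          Complex.exp ((-2 * Real.pi * w * x : ℝ) * Complex.I) := by
      rw [← Complex.exp_add, ← Complex.exp_add]
      congr 1
      unfold zeta
      push_cast
      ring
    push_cast at this ⊢
    linear_combination ((t ^ (a - 1) : ℝ) : ℂ) * spec u w * this
  · have hK : Integrable (fun t : ℝ => ((t ^ (a - 1) * Real.exp (-(ε * t)) : ℝ) : ℂ))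
        (volume.restrict (Ioi 0)) := (integrableOn_rpow_mul_exp ha₀ hε).ofReal
    refine (hK.mul_prod (integrable_spec hu)).bdd_mul (c := 1)
      (f := fun p : ℝ × ℝ => Complex.exp ((-2 * Real.pi * p.2 * (x - p.1) : ℝ) * Complex.I)) ?_ ?_
    · exact Continuous.aestronglyMeasurable (by fun_prop)
    · exact ae_of_all _ fun p => by rw [Complex.norm_exp_ofReal_mul_I]

/-- Dominated convergence as `ε → 0+` on both sides: the undamped integrand dominates the left,
`|ζ|^(-a) |spec u|` the right, integrable because `a < 1`. -/
lemma integral_rpow_mul_comp_sub_eq {a : ℝ} (ha₀ : 0 < a) (ha₁ : a < 1) {u : ℝ → ℝ}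
    (hu : SmoothIntegrable u) (x : ℝ) :
    ((∫ t in Ioi (0 : ℝ), t ^ (a - 1) * u (x - t) : ℝ) : ℂ) =
      Real.Gamma a * 𝓕 (fun w => zeta w ^ ((-a : ℝ) : ℂ) * spec u w) x := by
  have hl : Filter.Tendsto (fun ε : ℝ => ∫ t in Ioi (0 : ℝ),
      ((t ^ (a - 1) * Real.exp (-(ε * t)) : ℝ) : ℂ) * u (x - t)) (nhdsWithin 0 (Ioi 0))
      (nhds (∫ t in Ioi (0 : ℝ), ((t ^ (a - 1) * u (x - t) : ℝ) : ℂ))) := by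
    refine tendsto_integral_filter_of_dominated_convergence
      (fun t => ‖t ^ (a - 1) * u (x - t)‖) ?_ ?_
      (integrableOn_rpow_mul_comp_sub ha₀ ha₁ hu x).norm ?_
    · refine Filter.Eventually.of_forall fun ε => Measurable.aestronglyMeasurable ?_
      have hc : Continuous fun t => u (x - t) := hu.1.continuous.comp (by fun_prop)
      exact (Complex.measurable_ofReal.comp (by fun_prop)).mul
        (Complex.measurable_ofReal.comp hc.measurable)
    · filter_upwards [self_mem_nhdsWithin] with ε hε
      filter_upwards [ae_restrict_mem measurableSet_Ioi] with t ht
      have hε : 0 < ε := hε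
      have ht : 0 < t := ht
      simp only [norm_mul, Complex.norm_real]
      gcongr
      refine mul_le_of_le_one_right (norm_nonneg _) ?_
      rw [Real.norm_of_nonneg (Real.exp_pos _).le, Real.exp_le_one_iff]
      have := mul_pos hε ht
      linarith
    · refine ae_of_all _ fun t => Filter.Tendsto.mono_left ?_ nhdsWithin_le_nhds
      have : Continuous fun ε : ℝ =>
          ((t ^ (a - 1) * Real.exp (-(ε * t)) : ℝ) : ℂ) * (u (x - t) : ℂ) := by fun_prop
      convert this.tendsto 0 using 2
      simp
  have hr : Filter.Tendsto (fun ε : ℝ => Real.Gamma a * ∫ w : ℝ, (1 / (ε + zeta w)) ^ (a : ℂ) *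
        (Complex.exp ((-2 * Real.pi * w * x : ℝ) * Complex.I) * spec u w)) (nhdsWithin 0 (Ioi 0))
      (nhds (Real.Gamma a * ∫ w : ℝ, zeta w ^ ((-a : ℝ) : ℂ) *
        (Complex.exp ((-2 * Real.pi * w * x : ℝ) * Complex.I) * spec u w))) := by
    refine Filter.Tendsto.const_mul _ ?_
    have hsm := (continuous_spec hu.integrable).measurable
    refine tendsto_integral_filter_of_dominated_convergence
      (fun w => ‖zeta w ^ ((-a : ℝ) : ℂ) * spec u w‖) ?_ ?_
      (integrable_mul_spec hu (s := -a) (by linarith) (by linarith) (measurable_zeta_cpow _)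
        fun w _ => (norm_zeta_cpow w _).le).norm ?_
    · refine Filter.Eventually.of_forall fun ε => Measurable.aestronglyMeasurable ?_
      have := continuous_zeta.measurable
      exact Measurable.mul (Measurable.pow_const (by fun_prop) _) (by fun_prop)
    · filter_upwards [self_mem_nhdsWithin] with ε hε
      filter_upwards [compl_mem_ae_iff.mpr (measure_singleton (0 : ℝ))] with w hw
      have hw : w ≠ 0 := hw
      rw [norm_mul, norm_mul, norm_mul, Complex.norm_exp_ofReal_mul_I, one_mul]
      refine mul_le_mul_of_nonneg_right ?_ (norm_nonneg _)
      rw [Complex.norm_cpow_real, Complex.norm_cpow_real, norm_div, norm_one,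
        Real.rpow_neg (norm_nonneg _), one_div, Real.inv_rpow (norm_nonneg _)]
      -- `ζ` is purely imaginary, so adding a real number cannot decrease the modulus.
      have h1 : ‖zeta w‖ ≤ ‖(ε : ℂ) + zeta w‖ := by
        have := Complex.abs_im_le_norm ((ε : ℂ) + zeta w)
        rw [norm_zeta]
        simpa [zeta, abs_of_pos Real.pi_pos] using this
      have h2 : 0 < ‖zeta w‖ := by
        rw [norm_zeta]
        have := Real.pi_pos
        positivity
      gcongr
    · filter_upwards [compl_mem_ae_iff.mpr (measure_singleton (0 : ℝ))] with w hw
      have hw : w ≠ 0 := hw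
      refine Filter.Tendsto.mono_left ?_ nhdsWithin_le_nhds
      refine Filter.Tendsto.mul_const _ ?_
      have hz : zeta w ≠ 0 := by simp [zeta, hw, Real.pi_ne_zero]
      have hsl : zeta w ∈ Complex.slitPlane := by
        rw [Complex.mem_slitPlane_iff]
        right
        simp [zeta, hw, Real.pi_ne_zero]
      have hc : ContinuousAt (fun ε : ℝ => (1 / ((ε : ℂ) + zeta w)) ^ (a : ℂ)) 0 := by
        refine ContinuousAt.cpow ?_ continuousAt_const ?_
        · exact ContinuousAt.div continuousAt_const (by fun_prop) (by simpa using hz)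
        · rw [Complex.mem_slitPlane_iff]
          right
          simp [zeta, hw, Real.pi_ne_zero]
      convert hc.tendsto using 2
      rw [Complex.ofReal_zero, zero_add, one_div,
        Complex.inv_cpow _ _ (Complex.slitPlane_arg_ne_pi hsl), Complex.ofReal_neg,
        Complex.cpow_neg]
  have heq := tendsto_nhds_unique (hl.congr' (by
    filter_upwards [self_mem_nhdsWithin] with ε hε
    exact integral_damped_eq ha₀ hu x hε)) hr
  rw [← integral_complex_ofReal, heq, Real.fourier_real_eq_integral_exp_smul]
  congr 2
  ext w
  rw [smul_eq_mul]
  ring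

/-! ### The Riemann–Liouville derivative as a Fourier integral. -/

lemma natCeil_eq_two {α : ℝ} (hα₁ : 1 < α) (hα₂ : α < 2) : ⌈α⌉₊ = 2 := by
  rw [Nat.ceil_eq_iff (by norm_num)]
  constructor <;> norm_num <;> linarith

lemma setOf_bot_lt (x : ℝ) : {s : ℝ | (⊥ : EReal) < (s : EReal) ∧ s < x} = Iio x := by
  ext s
  simp [EReal.bot_lt_coe]

lemma integrableOn_leftIntegral {α : ℝ} (hα₁ : 1 < α) (hα₂ : α < 2) {u : ℝ → ℝ}
    (hu : SmoothIntegrable u) (x : ℝ) :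
    IntegrableOn (fun s : ℝ => (x - s) ^ ((⌈α⌉₊ : ℝ) - α - 1) * u s) (Iio x) := by
  have h := integrableOn_rpow_mul_comp_sub (a := 2 - α) (by linarith) (by linarith) hu x
  have hmp := (Measure.measurePreserving_sub_left (volume : Measure ℝ) x).integrableOn_comp_preimage
    (measurableEmbedding_subLeft x)
    (f := fun s : ℝ => (x - s) ^ ((⌈α⌉₊ : ℝ) - α - 1) * u s) (s := Iio x)
  rw [← hmp, natCeil_eq_two hα₁ hα₂]
  simpa [Function.comp_def] using h

lemma leftIntegral_bot {α : ℝ} (hα₁ : 1 < α) (hα₂ : α < 2) (u : ℝ → ℝ) (x : ℝ) :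
    leftIntegral α ⊥ u x = ∫ t in Ioi (0 : ℝ), t ^ ((2 - α) - 1) * u (x - t) := by
  unfold leftIntegral
  rw [setOf_bot_lt, natCeil_eq_two hα₁ hα₂,
    ← (Measure.measurePreserving_sub_left (volume : Measure ℝ) x).setIntegral_preimage_emb
      (measurableEmbedding_subLeft x)]
  simp

lemma norm_pow_mul_zeta_cpow {w : ℝ} (hw : w ≠ 0) (n : ℕ) (s : ℝ) :
    ‖((w : ℂ) ^ n) * zeta w ^ (s : ℂ)‖ = (2 * Real.pi) ^ s * |w| ^ (n + s) := by
  rw [norm_mul, norm_zeta_cpow, norm_pow, Complex.norm_real, Real.norm_eq_abs,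
    Real.rpow_add (abs_pos.mpr hw), Real.rpow_natCast]
  ring

/-- Exponents `n + α - 2` with `n ≤ 2` lie in `(-1, 6)`; this permits two differentiations under the
Fourier integral. -/
lemma integrable_pow_smul {α : ℝ} (hα₁ : 1 < α) (hα₂ : α < 2) {u : ℝ → ℝ}
    (hu : SmoothIntegrable u) (n : ℕ) (hn : n ≤ 2) :
    Integrable (fun w : ℝ => w ^ n • (zeta w ^ ((-(2 - α) : ℝ) : ℂ) * spec u w)) := by
  have hn' : (n : ℝ) ≤ 2 := by exact_mod_cast hn
  have := integrable_mul_spec hu (s := n + -(2 - α)) (K := (2 * Real.pi) ^ (-(2 - α)))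
    (m := fun w => ((w : ℂ) ^ n) * zeta w ^ ((-(2 - α) : ℝ) : ℂ))
    (by have : (0 : ℝ) ≤ n := by positivity
        linarith) (by linarith)
    (Measurable.mul (by fun_prop) (measurable_zeta_cpow _))
    fun w hw => (norm_pow_mul_zeta_cpow hw _ _).le
  refine this.congr (ae_of_all _ fun w => ?_)
  simp [mul_assoc]

lemma ofReal_leftIntegral {α : ℝ} (hα₁ : 1 < α) (hα₂ : α < 2) {u : ℝ → ℝ}
    (hu : SmoothIntegrable u) :
    (fun x => (leftIntegral α ⊥ u x : ℂ)) = fun x => (Real.Gamma (2 - α) : ℂ) *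
      𝓕 (fun w => zeta w ^ ((-(2 - α) : ℝ) : ℂ) * spec u w) x := by
  ext x
  rw [leftIntegral_bot hα₁ hα₂, integral_rpow_mul_comp_sub_eq (by linarith) (by linarith) hu]

lemma contDiff_fourier_fractional {α : ℝ} (hα₁ : 1 < α) (hα₂ : α < 2) {u : ℝ → ℝ}
    (hu : SmoothIntegrable u) :
    ContDiff ℝ 2 (𝓕 (fun w => zeta w ^ ((-(2 - α) : ℝ) : ℂ) * spec u w)) := by
  refine Real.contDiff_fourier (N := 2) fun n hn => ?_
  have := (integrable_pow_smul hα₁ hα₂ hu n (by exact_mod_cast hn)).norm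
  simpa [norm_smul] using this

lemma contDiff_leftIntegral {α : ℝ} (hα₁ : 1 < α) (hα₂ : α < 2) {u : ℝ → ℝ}
    (hu : SmoothIntegrable u) : ContDiff ℝ 2 (leftIntegral α ⊥ u) := by
  have h := (contDiff_const (c := (Real.Gamma (2 - α) : ℂ))).mul
    (contDiff_fourier_fractional hα₁ hα₂ hu)
  have h2 := Complex.reCLM.contDiff.comp h
  have h3 := ofReal_leftIntegral hα₁ hα₂ hu
  convert h2 using 1
  ext x
  have := congrFun h3 x
  simp only [Function.comp_apply, Complex.reCLM_apply]
  rw [← this, Complex.ofReal_re]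

lemma leftRLExists_bot {α : ℝ} (hα₁ : 1 < α) (hα₂ : α < 2) {u : ℝ → ℝ}
    (hu : SmoothIntegrable u) : LeftRLExists α ⊥ u := by
  refine ⟨fun x => ?_, ?_⟩
  · rw [setOf_bot_lt]
    exact integrableOn_leftIntegral hα₁ hα₂ hu x
  · rw [natCeil_eq_two hα₁ hα₂]
    exact contDiff_leftIntegral hα₁ hα₂ hu

/-- Each derivative contributes a factor `ζ`, and `ζ² ζ^(-(2-α)) = ζ^α`. -/
lemma ofReal_leftRL {α : ℝ} (hα₁ : 1 < α) (hα₂ : α < 2) {u : ℝ → ℝ}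
    (hu : SmoothIntegrable u) (x : ℝ) :
    (leftRL α ⊥ u x : ℂ) = ∫ w : ℝ, Complex.exp ((-2 * Real.pi * w * x : ℝ) * Complex.I) *
      (zeta w ^ (α : ℂ) * spec u w) := by
  have hG : (Real.Gamma (2 - α) : ℂ) ≠ 0 := by
    exact_mod_cast (Real.Gamma_pos_of_pos (by linarith)).ne'
  unfold leftRL
  rw [natCeil_eq_two hα₁ hα₂, Complex.ofReal_mul,
    ← iteratedDeriv_ofReal_comp (contDiff_leftIntegral hα₁ hα₂ hu),
    ofReal_leftIntegral hα₁ hα₂ hu, iteratedDeriv_const_mul_field,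
    Real.iteratedDeriv_fourier (N := 2) (n := 2)
      (fun n hn => integrable_pow_smul hα₁ hα₂ hu n (by exact_mod_cast hn)) le_rfl,
    ← mul_assoc]
  push_cast
  rw [one_div, inv_mul_cancel₀ hG, one_mul, Real.fourier_real_eq_integral_exp_smul]
  congr 1
  ext w
  rw [smul_eq_mul, smul_eq_mul, ← mul_assoc (_ ^ 2)]
  push_cast
  congr 2
  have hz : (-2 * (Real.pi : ℂ) * Complex.I * w) = zeta w := by
    unfold zeta
    push_cast
    ring
  rw [hz]
  -- Adding exponents needs a nonzero base; at `w = 0` both sides vanish.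
  by_cases h0 : zeta w = 0
  · have : (α : ℂ) ≠ 0 := by
      norm_cast
      linarith
    simp [h0, this]
  · rw [← Complex.cpow_ofNat, ← Complex.cpow_add _ _ h0]
    congr 1
    ring

/-! ### The symbol of the Grünwald operators. -/

/-- The angle at which the multipliers are evaluated. -/
noncomputable def angle (h w : ℝ) : ℝ := -2 * Real.pi * w * h

/-- Shifting by `-(k-p)h` multiplies the symbol by `e^{-i(k-p)θ}`. Summable weights allow exchanging
sum and integral, leaving the generating function at `e^{-iθ}`. -/
lemma hasSum_gWeight_mul {α : ℝ} (hα₁ : 1 < α) (hα₂ : α < 2) {u : ℝ → ℝ}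
    (hu : SmoothIntegrable u) (p : ℤ) (h x : ℝ) :
    HasSum (fun k : ℕ => (gWeight α k : ℂ) * u (x - ((k : ℝ) - (p : ℝ)) * h))
      (∫ w : ℝ, Complex.exp ((-2 * Real.pi * w * x : ℝ) * Complex.I) *
        ((1 - Complex.exp (-(angle h w * Complex.I))) ^ (α : ℂ) *
          Complex.exp (p * (angle h w * Complex.I)) * spec u w)) := by
  have hint : ∀ k : ℕ, Integrable (fun w : ℝ => (gWeight α k : ℂ) *
      (Complex.exp ((-2 * Real.pi * w * (x - ((k : ℝ) - (p : ℝ)) * h) : ℝ) * Complex.I) *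
        spec u w)) := fun k => by
    refine Integrable.const_mul ?_ _
    refine (integrable_spec hu).bdd_mul (c := 1)
      (Continuous.aestronglyMeasurable (by fun_prop)) (ae_of_all _ fun w => ?_)
    rw [Complex.norm_exp_ofReal_mul_I]
  have hs := hasSum_integral_of_summable_integral_norm hint (by
    simp only [norm_mul, Complex.norm_exp_ofReal_mul_I, one_mul, Complex.norm_real]
    simp_rw [integral_const_mul]
    exact ((summable_gWeight hα₁ hα₂).norm).mul_right _)
  simp_rw [integral_const_mul, ← eq_integral_spec hu] at hs
  have key : ∀ w : ℝ, Complex.exp ((-2 * Real.pi * w * x : ℝ) * Complex.I) *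
        ((1 - Complex.exp (-(angle h w * Complex.I))) ^ (α : ℂ) *
          Complex.exp (p * (angle h w * Complex.I)) * spec u w) =
      ∑' k : ℕ, (gWeight α k : ℂ) *
        (Complex.exp ((-2 * Real.pi * w * (x - ((k : ℝ) - (p : ℝ)) * h) : ℝ) * Complex.I) *
          spec u w) := fun w => by
    have hn : ‖Complex.exp (-(angle h w * Complex.I))‖ ≤ 1 := by
      rw [← neg_mul, ← Complex.ofReal_neg, Complex.norm_exp_ofReal_mul_I]
    rw [show Complex.exp ((-2 * Real.pi * w * x : ℝ) * Complex.I) *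
          ((1 - Complex.exp (-(angle h w * Complex.I))) ^ (α : ℂ) *
            Complex.exp (p * (angle h w * Complex.I)) * spec u w) =
       (1 - Complex.exp (-(angle h w * Complex.I))) ^ (α : ℂ) *
      (Complex.exp ((-2 * Real.pi * w * x : ℝ) * Complex.I) *
        Complex.exp (p * (angle h w * Complex.I)) * spec u w) by ring]
    rw [← ((hasSum_gWeight hα₁ hα₂ hn).mul_right
      (Complex.exp ((-2 * Real.pi * w * x : ℝ) * Complex.I) *
        Complex.exp (p * (angle h w * Complex.I)) * spec u w)).tsum_eq]
    congr 1
    ext k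
    have : Complex.exp (-(angle h w * Complex.I)) ^ k *
        (Complex.exp ((-2 * Real.pi * w * x : ℝ) * Complex.I) *
        Complex.exp (p * (angle h w * Complex.I))) =
        Complex.exp ((-2 * Real.pi * w * (x - ((k : ℝ) - (p : ℝ)) * h) : ℝ) * Complex.I) := by
      rw [← Complex.exp_nat_mul, ← Complex.exp_add, ← Complex.exp_add]
      congr 1
      unfold angle
      push_cast
      ring
    rw [← this]
    ring
  rw [funext key]
  exact hs

lemma summable_gWeight_mul {α : ℝ} (hα₁ : 1 < α) (hα₂ : α < 2) {u : ℝ → ℝ}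
    (hu : SmoothIntegrable u) (p : ℤ) (h x : ℝ) :
    Summable (fun k : ℕ => gWeight α k * u (x - ((k : ℝ) - (p : ℝ)) * h)) := by
  have := (hasSum_gWeight_mul hα₁ hα₂ hu p h x).summable
  exact_mod_cast this

lemma ofReal_leftGL {α : ℝ} (hα₁ : 1 < α) (hα₂ : α < 2) {u : ℝ → ℝ}
    (hu : SmoothIntegrable u) (p : ℤ) (h x : ℝ) :
    (leftGL α h p u x : ℂ) = (1 / h ^ α : ℝ) *
      ∫ w : ℝ, Complex.exp ((-2 * Real.pi * w * x : ℝ) * Complex.I) *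
        ((1 - Complex.exp (-(angle h w * Complex.I))) ^ (α : ℂ) *
          Complex.exp (p * (angle h w * Complex.I)) * spec u w) := by
  unfold leftGL
  rw [← (hasSum_gWeight_mul hα₁ hα₂ hu p h x).tsum_eq]
  push_cast
  rfl

/-! ### The error of the left scheme on the line. -/

/-- The error of the left scheme with step `h` at `x`. -/
noncomputable def leftError (α : ℝ) (u : ℝ → ℝ) (h x : ℝ) : ℝ :=
  cwsgd α h (leftRL α ⊥ u) x -
    (muOne α * leftGL α h 1 u x + muZero α * leftGL α h 0 u x + muNegOne α * leftGL α h (-1) u x)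

lemma integrable_exp_mul_zeta {α : ℝ} (hα₁ : 1 < α) (hα₂ : α < 2) {u : ℝ → ℝ}
    (hu : SmoothIntegrable u) (x : ℝ) :
    Integrable (fun w : ℝ => Complex.exp ((-2 * Real.pi * w * x : ℝ) * Complex.I) *
      (zeta w ^ (α : ℂ) * spec u w)) := by
  refine (integrable_mul_spec hu (s := α) (by linarith) (by linarith) (measurable_zeta_cpow α)
    fun w _ => (norm_zeta_cpow w α).le).bdd_mul (c := 1)
      (Continuous.aestronglyMeasurable (by fun_prop)) (ae_of_all _ fun w => ?_)
  rw [Complex.norm_exp_ofReal_mul_I]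

lemma integrable_exp_mul_gl {α : ℝ} (hα : 0 < α) {u : ℝ → ℝ}
    (hu : SmoothIntegrable u) (p : ℤ) (h x : ℝ) :
    Integrable (fun w : ℝ => Complex.exp ((-2 * Real.pi * w * x : ℝ) * Complex.I) *
        ((1 - Complex.exp (-(angle h w * Complex.I))) ^ (α : ℂ) *
          Complex.exp (p * (angle h w * Complex.I)) * spec u w)) := by
  have hc : Continuous (angle h) := by
    unfold angle
    fun_prop
  refine Integrable.bdd_mul (c := 1) (Integrable.bdd_mul (c := 2 ^ α) (integrable_spec hu) ?_ ?_)
    (Continuous.aestronglyMeasurable (by fun_prop)) (ae_of_all _ fun w => ?_)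
  · have hm := hc.measurable
    refine Measurable.aestronglyMeasurable (Measurable.mul (Measurable.pow_const ?_ _) ?_)
    · exact Continuous.measurable (by fun_prop)
    · exact Continuous.measurable (by fun_prop)
  · refine ae_of_all _ fun w => ?_
    have : Complex.exp (p * (angle h w * Complex.I)) =
        Complex.exp ((p * angle h w : ℝ) * Complex.I) := by
      push_cast
      ring_nf
    rw [norm_mul, this, Complex.norm_exp_ofReal_mul_I, mul_one]
    exact norm_one_sub_exp_cpow_le hα _
  · rw [Complex.norm_exp_ofReal_mul_I]

lemma integral_scheme (c c₁ c₂ c₃ d₁ d₂ d₃ : ℂ) {F₁ F₂ F₃ G₁ G₂ G₃ : ℝ → ℂ}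
    (hF₁ : Integrable F₁) (hF₂ : Integrable F₂) (hF₃ : Integrable F₃) (hG₁ : Integrable G₁)
    (hG₂ : Integrable G₂) (hG₃ : Integrable G₃) :
    ∫ w, (c * (c₁ * F₁ w + c₂ * F₂ w + c₃ * F₃ w) - (d₁ * G₁ w + d₂ * G₂ w + d₃ * G₃ w)) =
      c * (c₁ * (∫ w, F₁ w) + c₂ * (∫ w, F₂ w) + c₃ * ∫ w, F₃ w) -
        (d₁ * (∫ w, G₁ w) + d₂ * (∫ w, G₂ w) + d₃ * ∫ w, G₃ w) := by
  have h₁ := hF₁.const_mul c₁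
  have h₂ := hF₂.const_mul c₂
  have h₃ := hF₃.const_mul c₃
  have k₁ := hG₁.const_mul d₁
  have k₂ := hG₂.const_mul d₂
  have k₃ := hG₃.const_mul d₃
  have h₁₂ : Integrable fun w => c₁ * F₁ w + c₂ * F₂ w := h₁.add h₂
  have h₁₂₃ : Integrable fun w => c₁ * F₁ w + c₂ * F₂ w + c₃ * F₃ w := h₁₂.add h₃
  have k₁₂ : Integrable fun w => d₁ * G₁ w + d₂ * G₂ w := k₁.add k₂
  have k₁₂₃ : Integrable fun w => d₁ * G₁ w + d₂ * G₂ w + d₃ * G₃ w := k₁₂.add k₃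
  rw [integral_sub (h₁₂₃.const_mul c) k₁₂₃, integral_const_mul, integral_add h₁₂ h₃,
    integral_add h₁ h₂, integral_add k₁₂ k₃, integral_add k₁ k₂]
  simp only [integral_const_mul]

lemma ofReal_leftError {α : ℝ} (hα₁ : 1 < α) (hα₂ : α < 2) {u : ℝ → ℝ}
    (hu : SmoothIntegrable u) {h : ℝ} (hh : 0 < h) (x : ℝ) :
    (leftError α u h x : ℂ) = (1 / h ^ α : ℝ) * ∫ w : ℝ,
      Complex.exp ((-2 * Real.pi * w * x : ℝ) * Complex.I) *
        (errSymbol α (angle h w) * spec u w) := by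
  have hD := fun y => integrable_exp_mul_zeta hα₁ hα₂ hu y
  have hS := fun p => integrable_exp_mul_gl (by linarith : 0 < α) hu p h x
  have hhα : ((h ^ α : ℝ) : ℂ) ≠ 0 := by exact_mod_cast (Real.rpow_pos_of_pos hh α).ne'
  have key : ∀ w : ℝ, Complex.exp ((-2 * Real.pi * w * x : ℝ) * Complex.I) *
      (errSymbol α (angle h w) * spec u w) =
      (h ^ α : ℝ) * ((1 - 2 * bTwo α : ℝ) *
        (Complex.exp ((-2 * Real.pi * w * x : ℝ) * Complex.I) * (zeta w ^ (α : ℂ) * spec u w)) +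
        bTwo α * (Complex.exp ((-2 * Real.pi * w * (x - h) : ℝ) * Complex.I) *
          (zeta w ^ (α : ℂ) * spec u w)) +
        bTwo α * (Complex.exp ((-2 * Real.pi * w * (x + h) : ℝ) * Complex.I) *
          (zeta w ^ (α : ℂ) * spec u w))) -
      (muOne α * (Complex.exp ((-2 * Real.pi * w * x : ℝ) * Complex.I) *
        ((1 - Complex.exp (-(angle h w * Complex.I))) ^ (α : ℂ) *
          Complex.exp ((1 : ℤ) * (angle h w * Complex.I)) * spec u w)) +
       muZero α * (Complex.exp ((-2 * Real.pi * w * x : ℝ) * Complex.I) *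
        ((1 - Complex.exp (-(angle h w * Complex.I))) ^ (α : ℂ) *
          Complex.exp ((0 : ℤ) * (angle h w * Complex.I)) * spec u w)) +
       muNegOne α * (Complex.exp ((-2 * Real.pi * w * x : ℝ) * Complex.I) *
        ((1 - Complex.exp (-(angle h w * Complex.I))) ^ (α : ℂ) *
          Complex.exp ((-1 : ℤ) * (angle h w * Complex.I)) * spec u w))) := fun w => by
    have e1 : Complex.exp ((-2 * Real.pi * w * (x - h) : ℝ) * Complex.I) =
        Complex.exp ((-2 * Real.pi * w * x : ℝ) * Complex.I) *
          Complex.exp (-(angle h w * Complex.I)) := by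
      rw [← Complex.exp_add]
      congr 1
      unfold angle
      push_cast
      ring
    have e2 : Complex.exp ((-2 * Real.pi * w * (x + h) : ℝ) * Complex.I) =
        Complex.exp ((-2 * Real.pi * w * x : ℝ) * Complex.I) *
          Complex.exp (angle h w * Complex.I) := by
      rw [← Complex.exp_add]
      congr 1
      unfold angle
      push_cast
      ring
    -- A positive real factor comes out of a principal power without a branch correction.
    have e3 : (angle h w * Complex.I) ^ (α : ℂ) = (h ^ α : ℝ) * zeta w ^ (α : ℂ) := by
      rw [Complex.ofReal_cpow hh.le]
      have : (angle h w * Complex.I) = (h : ℂ) * zeta w := by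
        unfold angle zeta
        push_cast
        ring
      rw [this]
      by_cases hz : zeta w = 0
      · have : (α : ℂ) ≠ 0 := by
          norm_cast
          linarith
        simp [hz, this]
      · have hhc : (h : ℂ) ≠ 0 := by exact_mod_cast hh.ne'
        rw [Complex.cpow_def_of_ne_zero (mul_ne_zero hhc hz), Complex.cpow_def_of_ne_zero hhc,
          Complex.cpow_def_of_ne_zero hz, Complex.log_ofReal_mul hh hz, ← Complex.ofReal_log hh.le,
          add_mul, Complex.exp_add]
    have e4 : ((1 + bTwo α * (2 * Real.cos (angle h w) - 2) : ℝ) : ℂ) =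
        (1 - 2 * bTwo α : ℝ) + bTwo α * Complex.exp (-(angle h w * Complex.I)) +
          bTwo α * Complex.exp (angle h w * Complex.I) := by
      have := Complex.two_cos (angle h w : ℂ)
      push_cast at this ⊢
      rw [← neg_mul]
      linear_combination (bTwo α : ℂ) * this
    unfold errSymbol glSymbol
    rw [e1, e2, e3, e4]
    simp only [Int.cast_one, one_mul, Int.cast_zero, zero_mul, Complex.exp_zero, mul_one,
      Int.cast_neg, neg_mul]
    ring
  have hGL : ∀ p : ℤ, ∫ w : ℝ, Complex.exp ((-2 * Real.pi * w * x : ℝ) * Complex.I) *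
        ((1 - Complex.exp (-(angle h w * Complex.I))) ^ (α : ℂ) *
          Complex.exp (p * (angle h w * Complex.I)) * spec u w) =
      (h ^ α : ℝ) * (leftGL α h p u x : ℂ) := fun p => by
    rw [ofReal_leftGL hα₁ hα₂ hu, ← mul_assoc, ← Complex.ofReal_mul, mul_one_div_cancel,
      Complex.ofReal_one, one_mul]
    exact_mod_cast hhα
  rw [funext key, integral_scheme _ _ _ _ _ _ _ (hD x) (hD (x - h)) (hD (x + h)) (hS 1) (hS 0)
    (hS (-1)), hGL, hGL, hGL, ← ofReal_leftRL hα₁ hα₂ hu, ← ofReal_leftRL hα₁ hα₂ hu,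
    ← ofReal_leftRL hα₁ hα₂ hu]
  have hhα' : h ^ α ≠ 0 := (Real.rpow_pos_of_pos hh α).ne'
  have hh' : h ≠ 0 := hh.ne'
  unfold leftError cwsgd centeredDiff
  norm_cast
  generalize h ^ α = H at hhα' ⊢
  field_simp
  ring

/-- The symbol bound yields `h^α h^4`, and `h^α` cancels the prefactor. The estimate holds for every
`h > 0`, so the threshold `1` is arbitrary. -/
lemma uniformBigO_leftError {α : ℝ} (hα₁ : 1 < α) (hα₂ : α < 2) {u : ℝ → ℝ}
    (hu : SmoothIntegrable u) : UniformBigO univ (leftError α u) := by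
  obtain ⟨C, hC, hb⟩ := norm_errSymbol_le hα₁ hα₂
  refine ⟨C * (2 * Real.pi) ^ α * (2 * Real.pi) ^ 4 * ∫ w, |w| ^ (α + 4) * ‖spec u w‖, 1, one_pos,
    fun h hh _ x _ => ?_⟩
  have hhα : 0 < h ^ α := Real.rpow_pos_of_pos hh α
  have hn : |leftError α u h x| = ‖(leftError α u h x : ℂ)‖ := by simp
  rw [hn, ofReal_leftError hα₁ hα₂ hu hh, norm_mul, Complex.norm_real,
    Real.norm_of_nonneg (by positivity)]
  have hI : ‖∫ w : ℝ, Complex.exp ((-2 * Real.pi * w * x : ℝ) * Complex.I) *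
        (errSymbol α (angle h w) * spec u w)‖ ≤
      ∫ w : ℝ, (C * (2 * Real.pi) ^ α * (2 * Real.pi) ^ 4 * h ^ α * h ^ 4) *
        (|w| ^ (α + 4) * ‖spec u w‖) := by
    refine norm_integral_le_of_norm_le
      ((integrable_rpow_mul_spec hu (by linarith) (by linarith)).const_mul _)
      (ae_of_all _ fun w => ?_)
    rw [norm_mul, Complex.norm_exp_ofReal_mul_I, one_mul, norm_mul, ← mul_assoc]
    refine mul_le_mul_of_nonneg_right ((hb _).trans (le_of_eq ?_)) (norm_nonneg _)
    have h1 : |angle h w| = 2 * Real.pi * |w| * h := by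
      simp [angle, abs_mul, abs_of_pos hh, abs_of_pos Real.pi_pos]
    have h2 : angle h w ^ 4 = |angle h w| ^ 4 := by rw [(show Even 4 by decide).pow_abs]
    have h3 : |w| ^ (α + 4) = |w| ^ α * |w| ^ 4 := by
      rw [Real.rpow_add_of_nonneg (abs_nonneg _) (by linarith) (by norm_num)]
      congr 1
      exact_mod_cast Real.rpow_natCast |w| 4
    rw [h2, h1, h3, Real.mul_rpow (by positivity) hh.le, Real.mul_rpow (by positivity) (abs_nonneg _)]
    ring
  rw [integral_const_mul] at hI
  calc 1 / h ^ α * _ ≤ 1 / h ^ α * _ := mul_le_mul_of_nonneg_left hI (by positivity)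
    _ = _ := by field_simp

/-! ### Reflection `x ↦ -x` from left to right operators. -/

lemma SmoothIntegrable.comp_neg {u : ℝ → ℝ} (hu : SmoothIntegrable u) :
    SmoothIntegrable (fun x => u (-x)) := by
  refine ⟨hu.1.comp contDiff_neg, fun k hk => ?_⟩
  have : iteratedDeriv k (fun x => u (-x)) = fun x => (-1 : ℝ) ^ k • iteratedDeriv k u (-x) :=
    funext fun x => iteratedDeriv_comp_neg k u x
  rw [this]
  exact ((hu.2 k hk).comp_neg).const_mul _

lemma image_neg_setOf (b : EReal) (x : ℝ) :
    (fun s : ℝ => -s) ⁻¹' {s : ℝ | x < s ∧ (s : EReal) < b} =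
      {s : ℝ | -b < (s : EReal) ∧ s < -x} := by
  ext s
  simp only [mem_preimage, mem_ofPred_eq, EReal.coe_neg]
  rw [EReal.neg_lt_comm, lt_neg, and_comm]

lemma rightIntegral_eq (α : ℝ) (b : EReal) (u : ℝ → ℝ) :
    rightIntegral α b u = fun x => leftIntegral α (-b) (fun s => u (-s)) (-x) := by
  ext x
  unfold rightIntegral leftIntegral
  rw [← (Measure.measurePreserving_neg (volume : Measure ℝ)).setIntegral_preimage_emb
    (MeasurableEquiv.neg ℝ).measurableEmbedding]
  rw [← image_neg_setOf]
  congr 1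
  ext s
  congr 2
  ring

/-- The order of differentiation is `2`, so reflection produces no sign. -/
lemma rightRL_eq {α : ℝ} (hα₁ : 1 < α) (hα₂ : α < 2) (b : EReal) (u : ℝ → ℝ) :
    rightRL α b u = fun x => leftRL α (-b) (fun s => u (-s)) (-x) := by
  ext x
  unfold rightRL leftRL
  rw [rightIntegral_eq, iteratedDeriv_comp_neg, natCeil_eq_two hα₁ hα₂]
  norm_num

lemma RightRLExists.of_left {α : ℝ} {b : EReal} {u : ℝ → ℝ}
    (h : LeftRLExists α (-b) (fun s => u (-s))) : RightRLExists α b u := by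
  refine ⟨fun x => ?_, ?_⟩
  · rw [← (Measure.measurePreserving_neg (volume : Measure ℝ)).integrableOn_comp_preimage
      (MeasurableEquiv.neg ℝ).measurableEmbedding, image_neg_setOf]
    refine (h.1 (-x)).congr_fun_ae (ae_of_all _ fun s => ?_)
    simp only [Function.comp_apply]
    congr 2
    ring
  · rw [rightIntegral_eq]
    exact h.2.comp contDiff_neg

lemma cwsgd_comp_neg (α h : ℝ) (v : ℝ → ℝ) (x : ℝ) :
    cwsgd α h (fun y => v (-y)) x = cwsgd α h v (-x) := by
  unfold cwsgd centeredDiff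
  beta_reduce
  rw [show -(x - h) = -x + h by ring, show -(x + h) = -x - h by ring]
  ring

lemma rightGL_eq (α h : ℝ) (p : ℤ) (u : ℝ → ℝ) (x : ℝ) :
    rightGL α h p u x = leftGL α h p (fun s => u (-s)) (-x) := by
  unfold rightGL leftGL
  congr 2
  ext k
  congr 2
  ring

lemma rightGLFinite_eq (α b h : ℝ) (p : ℤ) (u : ℝ → ℝ) (x : ℝ) :
    rightGLFinite α b h p u x = leftGLFinite α (-b) h p (fun s => u (-s)) (-x) := by
  unfold rightGLFinite leftGLFinite
  rw [show -x - -b = b - x by ring]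
  congr 2
  ext k
  congr 2
  ring

lemma UniformBigO.comp_neg {S : Set ℝ} {E : ℝ → ℝ → ℝ} (h : UniformBigO univ E) :
    UniformBigO S (fun s x => E s (-x)) := by
  obtain ⟨C, h₀, hh, hb⟩ := h
  exact ⟨C, h₀, hh, fun s h1 h2 x _ => hb s h1 h2 (-x) (mem_univ _)⟩

lemma UniformBigO.mono {S T : Set ℝ} {E : ℝ → ℝ → ℝ} (h : UniformBigO T E) (hST : S ⊆ T) :
    UniformBigO S E := by
  obtain ⟨C, h₀, hh, hb⟩ := h
  exact ⟨C, h₀, hh, fun s h1 h2 x hx => hb s h1 h2 x (hST hx)⟩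

lemma UniformBigO.congr {S : Set ℝ} {E E' : ℝ → ℝ → ℝ} (h : UniformBigO S E)
    (hE : ∀ s, 0 < s → ∀ x, E' s x = E s x) : UniformBigO S E' := by
  obtain ⟨C, h₀, hh, hb⟩ := h
  exact ⟨C, h₀, hh, fun s h1 h2 x hx => by rw [hE s h1]; exact hb s h1 h2 x hx⟩

/-! ### Functions vanishing to the left of `a`. -/

lemma leftIntegral_eq_bot {α a : ℝ} {u : ℝ → ℝ} (hu : ∀ s ≤ a, u s = 0) :
    leftIntegral α a u = leftIntegral α ⊥ u := by
  ext x
  unfold leftIntegral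
  refine (setIntegral_eq_of_subset_of_forall_sdiff_eq_zero ?_ ?_ ?_).symm
  · rw [setOf_bot_lt]
    exact measurableSet_Iio
  · exact fun s hs => ⟨EReal.bot_lt_coe s, hs.2⟩
  · intro s hs
    have : s ≤ a := by
      by_contra hcon
      push Not at hcon
      exact hs.2 ⟨by exact_mod_cast hcon, hs.1.2⟩
    rw [hu s this, mul_zero]

lemma leftRL_eq_bot {α a : ℝ} {u : ℝ → ℝ} (hu : ∀ s ≤ a, u s = 0) :
    leftRL α a u = leftRL α ⊥ u := by
  unfold leftRL
  rw [leftIntegral_eq_bot hu]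

lemma LeftRLExists.of_bot {α a : ℝ} {u : ℝ → ℝ} (h : LeftRLExists α ⊥ u)
    (hu : ∀ s ≤ a, u s = 0) : LeftRLExists α a u := by
  refine ⟨fun x => (h.1 x).mono_set fun s hs => ⟨EReal.bot_lt_coe s, hs.2⟩, ?_⟩
  rw [leftIntegral_eq_bot hu]
  exact h.2

lemma leftGLFinite_eq {α a h : ℝ} (hh : 0 < h) {u : ℝ → ℝ} (hu : ∀ s ≤ a, u s = 0) (p : ℤ)
    (x : ℝ) : leftGLFinite α a h p u x = leftGL α h p u x := by
  unfold leftGLFinite leftGL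
  rw [tsum_eq_sum]
  intro k hk
  rw [Finset.mem_range, not_lt, Int.toNat_le] at hk
  -- The first omitted index has `k - p = ⌊(x-a)/h⌋ + 1 > (x-a)/h` when it is nonnegative; all
  -- omitted nodes lie left of `a`.
  have h1 : ((⌊(x - a) / h⌋ : ℝ) + 1) ≤ (k : ℝ) - p := by
    have : (⌊(x - a) / h⌋ : ℝ) + p + 1 ≤ k := by exact_mod_cast hk
    linarith
  have h2 := (Int.lt_floor_add_one ((x - a) / h)).trans_le h1
  rw [div_lt_iff₀ hh] at h2
  rw [hu _ (by linarith), mul_zero]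

/-- The zero extension keeps the endpoint values of `u`; its continuity forces them to be `0`. -/
lemma eq_zero_of_le_of_continuous {u : ℝ → ℝ} (hu : Continuous u) {a : ℝ}
    (h : ∀ s < a, u s = 0) : ∀ s ≤ a, u s = 0 := by
  have h1 : EqOn u (fun _ => 0) (closure (Iio a)) :=
    EqOn.closure (fun s hs => h s hs) hu continuous_const
  rw [closure_Iio] at h1
  exact fun s hs => h1 hs

/-- The error of the left scheme on the half line `[a, ∞)`. -/
noncomputable def leftErrorFinite (α a : ℝ) (u : ℝ → ℝ) (h x : ℝ) : ℝ :=
  cwsgd α h (leftRL α a u) x -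
    (muOne α * leftGLFinite α a h 1 u x + muZero α * leftGLFinite α a h 0 u x +
      muNegOne α * leftGLFinite α a h (-1) u x)

lemma uniformBigO_leftErrorFinite {α a : ℝ} (hα₁ : 1 < α) (hα₂ : α < 2) {u : ℝ → ℝ}
    (hu : SmoothIntegrable u) (h0 : ∀ s ≤ a, u s = 0) :
    UniformBigO univ (leftErrorFinite α a u) := by
  refine (uniformBigO_leftError hα₁ hα₂ hu).congr fun h hh x => ?_
  unfold leftErrorFinite leftError
  rw [leftRL_eq_bot h0, leftGLFinite_eq hh h0, leftGLFinite_eq hh h0, leftGLFinite_eq hh h0]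

end QuasiCompact

theorem mainTheorem3 (α : ℝ) (hα₁ : 1 < α) (hα₂ : α < 2) :
    (∀ u : ℝ → ℝ, QuasiCompact.SmoothIntegrable u →
      (QuasiCompact.LeftRLExists α ⊥ u ∧
        (∀ (p : ℤ) (h : ℝ), 0 < h → ∀ x : ℝ, Summable (fun k : ℕ =>
          QuasiCompact.gWeight α k * u (x - ((k : ℝ) - (p : ℝ)) * h))) ∧
        QuasiCompact.UniformBigO Set.univ (fun h x =>
          QuasiCompact.cwsgd α h (QuasiCompact.leftRL α ⊥ u) x -
            (QuasiCompact.muOne α * QuasiCompact.leftGL α h 1 u x +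
              QuasiCompact.muZero α * QuasiCompact.leftGL α h 0 u x +
              QuasiCompact.muNegOne α * QuasiCompact.leftGL α h (-1) u x))) ∧
      (QuasiCompact.RightRLExists α ⊤ u ∧
        (∀ (p : ℤ) (h : ℝ), 0 < h → ∀ x : ℝ, Summable (fun k : ℕ =>
          QuasiCompact.gWeight α k * u (x + ((k : ℝ) - (p : ℝ)) * h))) ∧
        QuasiCompact.UniformBigO Set.univ (fun h x =>
          QuasiCompact.cwsgd α h (QuasiCompact.rightRL α ⊤ u) x -
            (QuasiCompact.muOne α * QuasiCompact.rightGL α h 1 u x +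
              QuasiCompact.muZero α * QuasiCompact.rightGL α h 0 u x +
              QuasiCompact.muNegOne α * QuasiCompact.rightGL α h (-1) u x)))) ∧
    (∀ (a b : ℝ), a < b → ∀ u : ℝ → ℝ,
      QuasiCompact.SmoothIntegrable (QuasiCompact.zeroExt a b u) →
      (QuasiCompact.LeftRLExists α (a : EReal) (QuasiCompact.zeroExt a b u) ∧
        QuasiCompact.UniformBigO (Set.Icc a b) (fun h x =>
          QuasiCompact.cwsgd α h
              (QuasiCompact.leftRL α (a : EReal) (QuasiCompact.zeroExt a b u)) x -
            (QuasiCompact.muOne α *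
                QuasiCompact.leftGLFinite α a h 1 (QuasiCompact.zeroExt a b u) x +
              QuasiCompact.muZero α *
                QuasiCompact.leftGLFinite α a h 0 (QuasiCompact.zeroExt a b u) x +
              QuasiCompact.muNegOne α *
                QuasiCompact.leftGLFinite α a h (-1) (QuasiCompact.zeroExt a b u) x))) ∧
      (QuasiCompact.RightRLExists α (b : EReal) (QuasiCompact.zeroExt a b u) ∧
        QuasiCompact.UniformBigO (Set.Icc a b) (fun h x =>
          QuasiCompact.cwsgd α h
              (QuasiCompact.rightRL α (b : EReal) (QuasiCompact.zeroExt a b u)) x -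
            (QuasiCompact.muOne α *
                QuasiCompact.rightGLFinite α b h 1 (QuasiCompact.zeroExt a b u) x +
              QuasiCompact.muZero α *
                QuasiCompact.rightGLFinite α b h 0 (QuasiCompact.zeroExt a b u) x +
              QuasiCompact.muNegOne α *
                QuasiCompact.rightGLFinite α b h (-1) (QuasiCompact.zeroExt a b u) x)))) := by

  open QuasiCompact in
  refine ⟨fun u hu => ⟨⟨leftRLExists_bot hα₁ hα₂ hu,
    fun p h _ x => summable_gWeight_mul hα₁ hα₂ hu p h x, uniformBigO_leftError hα₁ hα₂ hu⟩,
    RightRLExists.of_left (leftRLExists_bot hα₁ hα₂ hu.comp_neg), fun p h _ x => ?_, ?_⟩,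
    fun a b _ u hu => ?_⟩
  · convert summable_gWeight_mul hα₁ hα₂ hu.comp_neg p h (-x) using 4
    ring
  · refine (uniformBigO_leftError hα₁ hα₂ hu.comp_neg).comp_neg.congr fun h _ x => ?_
    rw [rightRL_eq hα₁ hα₂, cwsgd_comp_neg, rightGL_eq, rightGL_eq, rightGL_eq]
    rfl
  · have hl : ∀ s ≤ a, zeroExt a b u s = 0 :=
      eq_zero_of_le_of_continuous hu.1.continuous fun s hs =>
        Set.indicator_of_notMem (fun h => absurd h.1 (not_le.mpr hs)) _
    -- The right end `b` becomes the left end `-b` of the reflected function.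
    have hr : ∀ s ≤ -b, zeroExt a b u (-s) = 0 :=
      eq_zero_of_le_of_continuous hu.comp_neg.1.continuous fun s hs =>
        Set.indicator_of_notMem (fun h => by linarith [h.2]) _
    refine ⟨⟨(leftRLExists_bot hα₁ hα₂ hu).of_bot hl,
      (uniformBigO_leftErrorFinite hα₁ hα₂ hu hl).mono (Set.subset_univ _)⟩,
      RightRLExists.of_left ?_, ?_⟩
    · rw [← EReal.coe_neg]
      exact (leftRLExists_bot hα₁ hα₂ hu.comp_neg).of_bot hr
    · refine (uniformBigO_leftErrorFinite hα₁ hα₂ hu.comp_neg hr).comp_neg.congr fun h _ x => ?_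
      rw [rightRL_eq hα₁ hα₂, cwsgd_comp_neg, rightGLFinite_eq, rightGLFinite_eq,
        rightGLFinite_eq, ← EReal.coe_neg]
      rfl
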